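/- Let $\sigma_x,\sigma_y,\sigma_z$ be the Pauli operators and, for $\alpha\in[0,1]$, let $\mathcal D_\alpha(\rho)=(1-\alpha)\rho+\frac{\alpha}{3}(\sigma_x\rho\sigma_x+\sigma_y\rho\sigma_y+\sigma_z\rho\sigma_z)$ be the qubit depolarizing channel and $\mathcal Z_\alpha(\rho)=(1-\alpha)\rho+\alpha\,\sigma_z\rho\sigma_z$ the qubit dephasing channel. For a channel $\mathcal N_{A\to B}$, an integer $n\ge 1$ and $\varepsilon\in[0,1)$, let $\hat R_{\mathcal N}(n;\varepsilon)$ be the maximum of all real $R$ for which there are an integer $m\ge1$ and channels (completely positive trace-preserving maps) $\mathcal E_{M'\to A^n}$ and $\mathcal G_{B^n\to M''}$, with $|M|=|M'|=|M''|=m$, such that $$\tfrac1n\log_2 m\ge R\quad\text{and}\quad F\big(\phi_{MM'},(\mathcal G\circ\mathcal N^{\otimes n}\circ\mathcal E)(\phi_{MM'})\big)\ge 1-\varepsilon ,$$ where $\phi_{MM'}$ is the maximally entangled state of local dimension $m$ and $F(\rho,\sigma)=\|\sqrt\rho\sqrt\sigma\|_1^2$. Let $\hat R^{\mathrm{cpp}}_{\mathcal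 N}(n;\varepsilon)$ be the same maximum for codes assisted by classical post-processing: the encoder $\mathcal E_{M'\to A^nQ}$ may keep a finite-dimensional local memory $Q$ at the sender, and the decoder $\mathcal G_{QB^n\to M''}$ is any channel with output at the receiver that is implemented by finitely many rounds of local operations and classical communication with respect to $Q:B^n$. Let $P_{XY}$ be the joint distribution of a uniform bit $X$ and the output $Y$ of a binary symmetric channel with crossover probability $\alpha$ on input $X$, let $P_X,Q_Y$ be uniform on $\{0,1\}$, and let $D_H^\varepsilon(P\|Q)=-\log_2\min\{\sum_z\Lambda(z)Q(z): 0\le\Lambda\le1,\ \sum_z\Lambda(z)P(z)\ge1-\varepsilon\}$. Then, for all $\alpha\in[0,1]$ and $\varepsilon\in[0,1)$, the following holds. (1) For all $n\ge1$ the four maxima defining $\hat R_{\mathcal D_\alpha}(n;\varepsilon)$, $\hat R_{\mathcal Z_\alpha}(n;\varepsilon)$, $\hat R^{\mathrm{cpp}}_{\mathcal D_\alpha}(n;\varepsilon)$, $\hat R^{\mathrm{cpp}}_{\mathcal Z_\alpha}(n;\varepsilon)$ exist, and $$\hat R_{\mathcal D_\alpha}(n;\varepsilon)\le\hat R_{\mathcal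 Z_\alpha}(n;\varepsilon),\qquad \hat R^{\mathrm{cpp}}_{\mathcal D_\alpha}(n;\varepsilon)\le\hat R^{\mathrm{cpp}}_{\mathcal Z_\alpha}(n;\varepsilon)\le\frac1n D_H^\varepsilon\big(P_{XY}^{\times n}\big\|P_X^{\times n}\times Q_Y^{\times n}\big).$$ (2) The assisted rate of the depolarizing channel exceeds the unassisted rate of the dephasing channel by at most $O(1/n)$: there is a constant $C$, depending only on $\alpha$ and $\varepsilon$, such that for all $n\ge1$ $$\hat R^{\mathrm{cpp}}_{\mathcal D_\alpha}(n;\varepsilon)\le\hat R_{\mathcal Z_\alpha}(n;\varepsilon)+\frac Cn .$$ -/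

import Mathlib

open Matrix
open scoped Kronecker ComplexOrder MatrixOrder

/-! Operators on the Hilbert space with orthonormal basis indexed by a finite type `a` are the
matrices `Matrix a a ℂ`; the tensor product of two systems is indexed by a product type and the
`n`-fold tensor power of `a` by `Fin n → a`. -/

noncomputable section

namespace QuantumCoding

/-! ### Quantum channels -/

/-- The map `id_r ⊗ Φ`, for a linear map `Φ` on operators. -/
def ampliate {a b : Type} (r : Type) (Φ : Matrix a a ℂ →ₗ[ℂ] Matrix b b ℂ) :
    Matrix (r × a) (r × a) ℂ →ₗ[ℂ] Matrix (r × b) (r × b) ℂ where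
  toFun X := Matrix.of fun x y => Φ (Matrix.of fun i j => X (x.1, i) (y.1, j)) x.2 y.2
  map_add' X Y := by
    ext x y
    have h : (Matrix.of fun i j => (X + Y) (x.1, i) (y.1, j)) =
        (Matrix.of fun i j => X (x.1, i) (y.1, j)) +
          (Matrix.of fun i j => Y (x.1, i) (y.1, j)) := by
      ext i j; rfl
    simp only [Matrix.of_apply, Matrix.add_apply] at h ⊢
    rw [h, map_add, Matrix.add_apply]
  map_smul' c X := by
    ext x y
    have h : (Matrix.of fun i j => (c • X) (x.1, i) (y.1, j)) =
        c • (Matrix.of fun i j => X (x.1, i) (y.1, j)) := by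
      ext i j; rfl
    simp only [Matrix.of_apply, Matrix.smul_apply, RingHom.id_apply] at h ⊢
    rw [h, map_smul, Matrix.smul_apply]

/-- Complete positivity: `id_k ⊗ Φ` preserves positive semidefiniteness for every `k`. -/
def IsCompletelyPositive {a b : Type} (Φ : Matrix a a ℂ →ₗ[ℂ] Matrix b b ℂ) : Prop :=
  ∀ (k : ℕ) (X : Matrix (Fin k × a) (Fin k × a) ℂ),
    X.PosSemidef → (ampliate (Fin k) Φ X).PosSemidef

/-- A quantum channel: a completely positive and trace preserving linear map. -/
def IsChannel {a b : Type} [Fintype a] [Fintype b]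
    (Φ : Matrix a a ℂ →ₗ[ℂ] Matrix b b ℂ) : Prop :=
  IsCompletelyPositive Φ ∧ ∀ X, (Φ X).trace = X.trace

/-- The tensor power `N^{⊗ n}`: the linear map with
`|i₁…iₙ⟩⟨j₁…jₙ| ↦ N(|i₁⟩⟨j₁|) ⊗ ⋯ ⊗ N(|iₙ⟩⟨jₙ|)`. -/
def tensorPow {a b : Type} [Fintype a] [DecidableEq a]
    (N : Matrix a a ℂ →ₗ[ℂ] Matrix b b ℂ) (n : ℕ) :
    Matrix (Fin n → a) (Fin n → a) ℂ →ₗ[ℂ] Matrix (Fin n → b) (Fin n → b) ℂ where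
  toFun X := Matrix.of fun k l =>
    ∑ i, ∑ j, X i j * ∏ t, N (Matrix.single (i t) (j t) 1) (k t) (l t)
  map_add' X Y := by
    ext k l
    simp [add_mul, Finset.sum_add_distrib]
  map_smul' c X := by
    ext k l
    simp [Finset.mul_sum, mul_assoc]

/-! ### States and fidelity -/

/-- The vector `m^{-1/2} ∑ₓ |x⟩ ⊗ |x⟩`. -/
def maxEntangledVec (m : ℕ) : Fin m × Fin m → ℂ :=
  fun x => if x.1 = x.2 then ((Real.sqrt m : ℝ) : ℂ)⁻¹ else 0

/-- The maximally entangled state `|φ⟩⟨φ|` of local dimension `m`. -/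
def maxEntangled (m : ℕ) : Matrix (Fin m × Fin m) (Fin m × Fin m) ℂ :=
  Matrix.vecMulVec (maxEntangledVec m) (star (maxEntangledVec m))

/-- The trace norm `‖X‖₁ = tr √(X X†)`. -/
def traceNorm {a : Type} [Fintype a] [DecidableEq a] (X : Matrix a a ℂ) : ℝ :=
  (CFC.sqrt (X * Xᴴ)).trace.re

/-- Uhlmann's fidelity `F(ρ, σ) = ‖√ρ √σ‖₁²`. -/
def fidelity {a : Type} [Fintype a] [DecidableEq a] (ρ σ : Matrix a a ℂ) : ℝ :=
  traceNorm (CFC.sqrt ρ * CFC.sqrt σ) ^ 2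

/-! ### Local operations and classical communication -/

/-- The map `X ↦ K X K†`. -/
def conjBy {a b : Type} [Fintype a] (K : Matrix b a ℂ) :
    Matrix a a ℂ →ₗ[ℂ] Matrix b b ℂ where
  toFun X := K * X * Kᴴ
  map_add' X Y := by rw [Matrix.mul_add, Matrix.add_mul]
  map_smul' c X := by simp

/-- `IsLOCC Φ`: the map `Φ`, from the bipartite system `a : b` (Alice : Bob) to the bipartite
system `c : d`, is implemented by a finite number of rounds of local operations and classical
communication. In a round, Alice or Bob performs a local quantum instrument with Kraus operators
`K i` and announces the outcome `i`, and the parties go on with an LOCC protocol `Φ i` that may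
depend on it. (An instrument with several Kraus operators for the same outcome is covered: the
protocols `Φ i` may ignore part of the label `i`.) -/
inductive IsLOCC {c d : Type} : ∀ {a b : Type},
    (Matrix (a × b) (a × b) ℂ →ₗ[ℂ] Matrix (c × d) (c × d) ℂ) → Prop
  | done : IsLOCC (LinearMap.id : Matrix (c × d) (c × d) ℂ →ₗ[ℂ] Matrix (c × d) (c × d) ℂ)
  | alice {a b a' ι : Type} [Fintype a] [DecidableEq a] [Fintype b] [DecidableEq b]
      [Fintype a'] [Fintype ι] (K : ι → Matrix a' a ℂ) (hK : ∑ i, (K i)ᴴ * K i = 1)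
      (Φ : ι → (Matrix (a' × b) (a' × b) ℂ →ₗ[ℂ] Matrix (c × d) (c × d) ℂ))
      (hΦ : ∀ i, IsLOCC (Φ i)) :
      IsLOCC (∑ i, Φ i ∘ₗ conjBy (K i ⊗ₖ (1 : Matrix b b ℂ)))
  | bob {a b b' ι : Type} [Fintype a] [DecidableEq a] [Fintype b] [DecidableEq b]
      [Fintype b'] [Fintype ι] (K : ι → Matrix b' b ℂ) (hK : ∑ i, (K i)ᴴ * K i = 1)
      (Φ : ι → (Matrix (a × b') (a × b') ℂ →ₗ[ℂ] Matrix (c × d) (c × d) ℂ))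
      (hΦ : ∀ i, IsLOCC (Φ i)) :
      IsLOCC (∑ i, Φ i ∘ₗ conjBy ((1 : Matrix a a ℂ) ⊗ₖ K i))

/-- The identification of operators on (one-dimensional system) `⊗ d` with operators on `d`. -/
def dropTrivial (d : Type) : Matrix (Unit × d) (Unit × d) ℂ →ₗ[ℂ] Matrix d d ℂ where
  toFun X := Matrix.of fun i j => X ((), i) ((), j)
  map_add' _ _ := rfl
  map_smul' _ _ := rfl

/-- Channels from the bipartite system `a : b` to a system `d` on Bob's side that are implemented
by local operations and classical communication (Alice is left with a trivial system). -/
def IsLOCCToBob {a b d : Type} (D : Matrix (a × b) (a × b) ℂ →ₗ[ℂ] Matrix d d ℂ) : Prop :=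
  ∃ Φ : Matrix (a × b) (a × b) ℂ →ₗ[ℂ] Matrix (Unit × d) (Unit × d) ℂ,
    IsLOCC Φ ∧ D = dropTrivial d ∘ₗ Φ

/-! ### Codes and the boundary of the achievable region -/

/-- `(R, n, ε)` is achievable on `N` by an entanglement transmission code `{m, E, D}` for
`N^{⊗ n}`. -/
def Achievable {a b : Type} [Fintype a] [DecidableEq a] [Fintype b] [DecidableEq b]
    (N : Matrix a a ℂ →ₗ[ℂ] Matrix b b ℂ) (R : ℝ) (n : ℕ) (ε : ℝ) : Prop :=
  ∃ (m : ℕ) (E : Matrix (Fin m) (Fin m) ℂ →ₗ[ℂ] Matrix (Fin n → a) (Fin n → a) ℂ)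
    (D : Matrix (Fin n → b) (Fin n → b) ℂ →ₗ[ℂ] Matrix (Fin m) (Fin m) ℂ),
    0 < m ∧ IsChannel E ∧ IsChannel D ∧
    R ≤ 1 / (n : ℝ) * Real.logb 2 m ∧
    1 - ε ≤ fidelity (maxEntangled m)
      (ampliate (Fin m) (D ∘ₗ tensorPow N n ∘ₗ E) (maxEntangled m))

/-- `(R, n, ε)` is achievable on `N` by an entanglement transmission code `{m, E, D}` for
`N^{⊗ n}` assisted by classical post-processing. The encoder has as output a local memory `Q` of
some dimension `q` besides the channel inputs; the decoder is an LOCC channel with respect to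
the bipartition `Q : Bⁿ` with output on the receiver's side. -/
def AchievableCpp {a b : Type} [Fintype a] [DecidableEq a] [Fintype b] [DecidableEq b]
    (N : Matrix a a ℂ →ₗ[ℂ] Matrix b b ℂ) (R : ℝ) (n : ℕ) (ε : ℝ) : Prop :=
  ∃ (m q : ℕ)
    (E : Matrix (Fin m) (Fin m) ℂ →ₗ[ℂ] Matrix (Fin q × (Fin n → a)) (Fin q × (Fin n → a)) ℂ)
    (D : Matrix (Fin q × (Fin n → b)) (Fin q × (Fin n → b)) ℂ →ₗ[ℂ] Matrix (Fin m) (Fin m) ℂ),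
    0 < m ∧ IsChannel E ∧ IsLOCCToBob D ∧
    R ≤ 1 / (n : ℝ) * Real.logb 2 m ∧
    1 - ε ≤ fidelity (maxEntangled m)
      (ampliate (Fin m) (D ∘ₗ ampliate (Fin q) (tensorPow N n) ∘ₗ E) (maxEntangled m))

/-- The boundary `R̂_N(n; ε)` of the achievable region. -/
def optRate {a b : Type} [Fintype a] [DecidableEq a] [Fintype b] [DecidableEq b]
    (N : Matrix a a ℂ →ₗ[ℂ] Matrix b b ℂ) (n : ℕ) (ε : ℝ) : ℝ :=
  sSup {R | Achievable N R n ε}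

/-- The boundary `R̂^cpp_N(n; ε)` of the achievable region with classical post-processing. -/
def optRateCpp {a b : Type} [Fintype a] [DecidableEq a] [Fintype b] [DecidableEq b]
    (N : Matrix a a ℂ →ₗ[ℂ] Matrix b b ℂ) (n : ℕ) (ε : ℝ) : ℝ :=
  sSup {R | AchievableCpp N R n ε}

/-! ### The two qubit channels -/

def pauliX : Matrix (Fin 2) (Fin 2) ℂ := !![0, 1; 1, 0]

def pauliY : Matrix (Fin 2) (Fin 2) ℂ := !![0, -Complex.I; Complex.I, 0]

def pauliZ : Matrix (Fin 2) (Fin 2) ℂ := !![1, 0; 0, -1]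

/-- The qubit dephasing channel `ρ ↦ (1 - γ) ρ + γ Z ρ Z`. -/
def dephasing (γ : ℝ) : Matrix (Fin 2) (Fin 2) ℂ →ₗ[ℂ] Matrix (Fin 2) (Fin 2) ℂ where
  toFun ρ := (1 - γ : ℂ) • ρ + (γ : ℂ) • (pauliZ * ρ * pauliZ)
  map_add' ρ σ := by
    simp only [Matrix.mul_add, Matrix.add_mul, smul_add]
    abel
  map_smul' c ρ := by
    simp only [Matrix.mul_smul, Matrix.smul_mul, smul_add, RingHom.id_apply, smul_comm c]

/-- The qubit depolarizing channel `ρ ↦ (1 - α) ρ + (α / 3) (X ρ X + Y ρ Y + Z ρ Z)`. -/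
def depolarizing (α : ℝ) : Matrix (Fin 2) (Fin 2) ℂ →ₗ[ℂ] Matrix (Fin 2) (Fin 2) ℂ where
  toFun ρ := (1 - α : ℂ) • ρ +
    (α / 3 : ℂ) • (pauliX * ρ * pauliX + pauliY * ρ * pauliY + pauliZ * ρ * pauliZ)
  map_add' ρ σ := by
    simp only [Matrix.mul_add, Matrix.add_mul, smul_add]
    abel
  map_smul' c ρ := by
    simp only [Matrix.mul_smul, Matrix.smul_mul, smul_add, RingHom.id_apply, smul_comm c]

/-! ### The hypothesis testing bound of the binary symmetric channel -/

/-- `β_{1-ε}(P‖Q)`, for distributions on a finite set: the least `Q`-weight of a test `Λ` that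
accepts `P` with probability at least `1 - ε`. -/
def hypoBeta {ι : Type} [Fintype ι] (ε : ℝ) (P Q : ι → ℝ) : ℝ :=
  sInf {r | ∃ Λ : ι → ℝ, (∀ z, 0 ≤ Λ z ∧ Λ z ≤ 1) ∧ 1 - ε ≤ ∑ z, Λ z * P z ∧
    r = ∑ z, Λ z * Q z}

/-- The hypothesis testing relative entropy `D_H^ε(P‖Q) = - log β_{1-ε}(P‖Q)`. -/
def hypoDiv {ι : Type} [Fintype ι] (ε : ℝ) (P Q : ι → ℝ) : ℝ :=
  -Real.logb 2 (hypoBeta ε P Q)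

/-- The joint distribution of a uniform input bit `X` and the output `Y` of the binary symmetric
channel with crossover probability `α`. -/
def bscJoint (α : ℝ) : Bool × Bool → ℝ :=
  fun z => if z.1 = z.2 then (1 - α) / 2 else α / 2

/-- The product distribution of two independent uniform bits. -/
def uniformPair : Bool × Bool → ℝ := fun _ => 1 / 2 * (1 / 2)

/-- The `n`-fold product of a distribution. -/
def iidPow {ι : Type} (n : ℕ) (P : ι → ℝ) : (Fin n → ι) → ℝ := fun z => ∏ t, P (z t)

end QuantumCoding

end

noncomputable section

namespace QuantumCoding

/-! ### Complete positivity -/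

section Basics

variable {a b c : Type}

/-! Every comparison goes through error patterns. The n-fold dephasing channel applies a random
phase error Z^s, where s in {0,1}^n has independent Bernoulli(α) entries (`tensorPow_dephasing`).
The depolarizing channel is the uniform mixture, over words of axes, of dephasing channels
conjugated by local unitaries taking Z to Z, X or Y (`tensorPow_depolarizing`). The fidelity with a
maximally entangled state is linear in the channel, so a depolarizing code is an average of
dephasing codes with these unitaries absorbed in encoder and decoder, and one of them is at least as
good.

Converse (`IsCode.exists_isTest`, `IsCppCode.exists_isTest`): for a code of size m let Λ(s) be its
entanglement fidelity when the error is Z^s. Its Bernoulli(α) mean is at least 1 - ε. Its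
Bernoulli(1/2) mean is at most 1/m: complete dephasing is a measurement, and with a decoder whose
Kraus operators are products, as for LOCC, the whole map is measure-and-prepare. Hence m ΣΛ ≤ 2^n
for some test Λ of the noise. Read as a test on X ⊕ Y, this is the D_H bound.

Achievability (`isCode_of_isTransversal`, `exists_code_error_le`): in the Hadamard basis phase
errors are bit flips, so a binary linear code C, by measuring cosets, corrects all errors in a
transversal of C. Multiplying a fixed subgroup by the units of GF(2^n) gives a family for which
minimum-weight representatives obey the random coding union bound.

The two sides meet up to a constant factor (`exists_matchesConverse`). For 0 < α < 1/2 let w₀ be the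
first Hamming radius whose ball has probability at least 1 - ε. By Neyman–Pearson every test has ΣΛ
at least the size of the ball of radius w₀ - 1. In the union bound at radius w₀ + 1 the sum is
dominated geometrically by its last term, so the probability of the extra shell pays for the coding
error as soon as |C| times the ball size is below a constant times 2^n. Balls of radii w₀ - 1 and w₀
+ 1 differ by a bounded factor, so no normal approximation is needed: Chebyshev's inequality locates
w₀ well enough. The cases α = 0, α = 1/2, ε = 0 and small n are direct, and α > 1/2 follows by
flipping all bits. -/

lemma ampliate_apply {r : Type} (Φ : Matrix a a ℂ →ₗ[ℂ] Matrix b b ℂ)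
    (X : Matrix (r × a) (r × a) ℂ) (x y : r × b) :
    ampliate r Φ X x y = Φ (Matrix.of fun i j => X (x.1, i) (y.1, j)) x.2 y.2 := rfl

lemma ampliate_comp {r : Type} (Ψ : Matrix b b ℂ →ₗ[ℂ] Matrix c c ℂ)
    (Φ : Matrix a a ℂ →ₗ[ℂ] Matrix b b ℂ) :
    ampliate r (Ψ ∘ₗ Φ) = ampliate r Ψ ∘ₗ ampliate r Φ := rfl

lemma ampliate_sum {r ι : Type} (s : Finset ι) (Φ : ι → Matrix a a ℂ →ₗ[ℂ] Matrix b b ℂ) :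
    ampliate r (∑ i ∈ s, Φ i) = ∑ i ∈ s, ampliate r (Φ i) := by
  ext X x y
  simp [ampliate_apply, LinearMap.sum_apply, Matrix.sum_apply]

lemma ampliate_smul {r : Type} (t : ℂ) (Φ : Matrix a a ℂ →ₗ[ℂ] Matrix b b ℂ) :
    ampliate r (t • Φ) = t • ampliate r Φ := rfl

lemma conjBy_apply [Fintype a] (K : Matrix b a ℂ) (X : Matrix a a ℂ) :
    conjBy K X = K * X * Kᴴ := rfl

lemma conjBy_apply_apply [Fintype a] (K : Matrix b a ℂ) (X : Matrix a a ℂ) (k l : b) :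
    conjBy K X k l = ∑ i, ∑ j, K k i * X i j * star (K l j) := by
  rw [conjBy_apply, Matrix.mul_apply, Finset.sum_comm]
  simp [Matrix.mul_apply, Finset.sum_mul]

lemma conjBy_comp [Fintype a] [Fintype b] (L : Matrix c b ℂ) (K : Matrix b a ℂ) :
    conjBy L ∘ₗ conjBy K = conjBy (L * K) := by
  refine LinearMap.ext fun X => ?_
  simp only [LinearMap.comp_apply, conjBy_apply, Matrix.conjTranspose_mul, Matrix.mul_assoc]

lemma ampliate_conjBy {r : Type} [Fintype r] [DecidableEq r] [Fintype a] (K : Matrix b a ℂ) :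
    ampliate r (conjBy K) = conjBy ((1 : Matrix r r ℂ) ⊗ₖ K) := by
  refine LinearMap.ext fun X => ?_
  ext x y
  rw [ampliate_apply, conjBy_apply_apply, conjBy_apply_apply]
  simp [Fintype.sum_prod_type, Matrix.kroneckerMap_apply, Matrix.one_apply, ite_mul, apply_ite,
    Finset.sum_ite_eq]

lemma trace_conjBy [Fintype a] [Fintype b] (K : Matrix b a ℂ) (X : Matrix a a ℂ) :
    (conjBy K X).trace = (Kᴴ * K * X).trace := by
  rw [conjBy_apply, Matrix.trace_mul_comm, Matrix.mul_assoc]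

lemma isCompletelyPositive_conjBy [Fintype a] [Fintype b] (K : Matrix b a ℂ) :
    IsCompletelyPositive (conjBy K) := by
  intro k X hX
  rw [ampliate_conjBy]
  exact hX.mul_mul_conjTranspose_same _

lemma IsCompletelyPositive.comp {Ψ : Matrix b b ℂ →ₗ[ℂ] Matrix c c ℂ}
    {Φ : Matrix a a ℂ →ₗ[ℂ] Matrix b b ℂ} (hΨ : IsCompletelyPositive Ψ)
    (hΦ : IsCompletelyPositive Φ) : IsCompletelyPositive (Ψ ∘ₗ Φ) :=
  fun k X hX => hΨ k _ (hΦ k X hX)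

lemma isCompletelyPositive_sum {ι : Type} (s : Finset ι)
    {Φ : ι → Matrix a a ℂ →ₗ[ℂ] Matrix b b ℂ} (h : ∀ i ∈ s, IsCompletelyPositive (Φ i)) :
    IsCompletelyPositive (∑ i ∈ s, Φ i) := by
  intro k X hX
  rw [ampliate_sum, LinearMap.sum_apply]
  exact Matrix.posSemidef_sum s fun i hi => h i hi k X hX

lemma IsCompletelyPositive.smul {Φ : Matrix a a ℂ →ₗ[ℂ] Matrix b b ℂ}
    (h : IsCompletelyPositive Φ) {t : ℝ} (ht : 0 ≤ t) :
    IsCompletelyPositive ((t : ℂ) • Φ) := by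
  intro k X hX
  rw [ampliate_smul, LinearMap.smul_apply]
  exact (h k X hX).smul (by exact_mod_cast ht)

lemma IsChannel.comp [Fintype a] [Fintype b] [Fintype c] {Ψ : Matrix b b ℂ →ₗ[ℂ] Matrix c c ℂ}
    {Φ : Matrix a a ℂ →ₗ[ℂ] Matrix b b ℂ} (hΨ : IsChannel Ψ) (hΦ : IsChannel Φ) :
    IsChannel (Ψ ∘ₗ Φ) :=
  ⟨hΨ.1.comp hΦ.1, fun X => by rw [LinearMap.comp_apply, hΨ.2, hΦ.2]⟩

lemma isChannel_sum_conjBy [Fintype a] [DecidableEq a] [Fintype b] {ι : Type} (s : Finset ι)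
    (K : ι → Matrix b a ℂ) (hK : ∑ i ∈ s, (K i)ᴴ * K i = 1) :
    IsChannel (∑ i ∈ s, conjBy (K i)) := by
  refine ⟨isCompletelyPositive_sum s fun i _ => isCompletelyPositive_conjBy _, fun X => ?_⟩
  rw [LinearMap.sum_apply, Matrix.trace_sum]
  simp_rw [trace_conjBy]
  rw [← Matrix.trace_sum, ← Finset.sum_mul, hK, Matrix.one_mul]

lemma isChannel_conjBy [Fintype a] [DecidableEq a] [Fintype b] {K : Matrix b a ℂ}
    (hK : Kᴴ * K = 1) : IsChannel (conjBy K) := by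
  simpa using isChannel_sum_conjBy {()} (fun _ => K) (by simpa using hK)

end Basics

/-! ### Positive semidefinite matrices -/

lemma PosSemidef.exists_eq_conjTranspose_mul_self {n : Type} [Fintype n] [DecidableEq n]
    {A : Matrix n n ℂ} (hA : A.PosSemidef) : ∃ B : Matrix n n ℂ, A = Bᴴ * B := by
  obtain ⟨B, hB⟩ := CStarAlgebra.nonneg_iff_eq_star_mul_self.mp hA.nonneg
  exact ⟨B, hB⟩

lemma normSq_sum_mul_le {n : Type} [Fintype n] (u v : n → ℂ) :
    Complex.normSq (∑ y, u y * v y) ≤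
      (∑ y, Complex.normSq (u y)) * ∑ y, Complex.normSq (v y) := by
  simp only [Complex.normSq_eq_norm_sq]
  calc ‖∑ y, u y * v y‖ ^ 2 ≤ (∑ y, ‖u y‖ * ‖v y‖) ^ 2 := by
        gcongr
        exact (norm_sum_le _ _).trans_eq (by simp)
    _ ≤ _ := Finset.sum_mul_sq_le_sq_mul_sq _ _ _

lemma trace_conjTranspose_mul_self_eq {n : Type} [Fintype n] (B : Matrix n n ℂ) :
    (Bᴴ * B).trace = ((∑ r, ∑ x, Complex.normSq (B r x) : ℝ) : ℂ) := by
  simp only [Matrix.trace, Matrix.diag_apply, Matrix.mul_apply, Matrix.conjTranspose_apply]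
  rw [Finset.sum_comm]
  push_cast
  simp [Complex.normSq_eq_conj_mul_self]

/-- The Hilbert–Schmidt pairing of two positive semidefinite matrices is nonnegative and at most
the product of their traces. -/
lemma sum_mul_mem_Icc_of_posSemidef {n : Type} [Fintype n] [DecidableEq n] {A B : Matrix n n ℂ}
    (hA : A.PosSemidef) (hB : B.PosSemidef) :
    (∑ x, ∑ y, A x y * B x y).re ∈ Set.Icc 0 (A.trace.re * B.trace.re) := by
  obtain ⟨C, rfl⟩ := PosSemidef.exists_eq_conjTranspose_mul_self hA
  obtain ⟨D, rfl⟩ := PosSemidef.exists_eq_conjTranspose_mul_self hB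
  -- Factoring both matrices as Gram matrices makes the pairing a sum of squared moduli. This gives
  -- positivity, and Cauchy–Schwarz on each square gives the trace bound.
  have h : ∑ x, ∑ y, (Cᴴ * C) x y * (Dᴴ * D) x y =
      ((∑ r, ∑ s, Complex.normSq (∑ y, C r y * D s y) : ℝ) : ℂ) := by
    push_cast
    simp only [Complex.normSq_eq_conj_mul_self, map_sum, map_mul, Matrix.mul_apply,
      Matrix.conjTranspose_apply, Finset.sum_mul_sum, RCLike.star_def]
    calc _ = ∑ x, ∑ y, ∑ r, ∑ s, (starRingEnd ℂ) (C r x) * C r y *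
            ((starRingEnd ℂ) (D s x) * D s y) := rfl
      _ = ∑ x, ∑ r, ∑ s, ∑ y, (starRingEnd ℂ) (C r x) * C r y *
            ((starRingEnd ℂ) (D s x) * D s y) := by
          refine Finset.sum_congr rfl fun x _ => ?_
          rw [Finset.sum_comm]
          exact Finset.sum_congr rfl fun r _ => Finset.sum_comm
      _ = ∑ r, ∑ s, ∑ x, ∑ y, (starRingEnd ℂ) (C r x) * C r y *
            ((starRingEnd ℂ) (D s x) * D s y) := by
          rw [Finset.sum_comm]
          exact Finset.sum_congr rfl fun r _ => Finset.sum_comm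
      _ = _ := by
          refine Finset.sum_congr rfl fun r _ => Finset.sum_congr rfl fun s _ =>
            Finset.sum_congr rfl fun x _ => Finset.sum_congr rfl fun y _ => ?_
          ring
  rw [h, trace_conjTranspose_mul_self_eq, trace_conjTranspose_mul_self_eq, Complex.ofReal_re,
    Complex.ofReal_re, Complex.ofReal_re]
  refine ⟨Finset.sum_nonneg fun r _ => Finset.sum_nonneg fun s _ => Complex.normSq_nonneg _, ?_⟩
  rw [Finset.sum_mul_sum]
  exact Finset.sum_le_sum fun r _ => Finset.sum_le_sum fun s _ => normSq_sum_mul_le _ _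

/-! ### Fidelity with the maximally entangled state -/

/-- The Choi matrix `∑ |x⟩⟨y| ⊗ Φ(|x⟩⟨y|)`. -/
def choi {a b : Type} [DecidableEq a] (Φ : Matrix a a ℂ →ₗ[ℂ] Matrix b b ℂ) :
    Matrix (a × b) (a × b) ℂ :=
  Matrix.of fun x y => Φ (Matrix.single x.1 y.1 1) x.2 y.2

/-- The entanglement fidelity `⟨φ|(id ⊗ Φ)(φ)|φ⟩` of `Φ`. -/
def entFid {m : ℕ} (Φ : Matrix (Fin m) (Fin m) ℂ →ₗ[ℂ] Matrix (Fin m) (Fin m) ℂ) : ℝ :=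
  (∑ x, ∑ y, Φ (Matrix.single x y 1) x y).re / (m : ℝ) ^ 2

lemma ampliate_maxEntangled {m : ℕ} {b : Type}
    (Φ : Matrix (Fin m) (Fin m) ℂ →ₗ[ℂ] Matrix b b ℂ) :
    ampliate (Fin m) Φ (maxEntangled m) = ((m : ℝ)⁻¹ : ℂ) • choi Φ := by
  ext ⟨x, k⟩ ⟨y, l⟩
  have h : (Matrix.of fun i j => maxEntangled m (x, i) (y, j)) =
      ((m : ℝ)⁻¹ : ℂ) • (Matrix.single x y 1 : Matrix (Fin m) (Fin m) ℂ) := by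
    ext i j
    have hs : (((Real.sqrt m : ℝ) : ℂ))⁻¹ * (((Real.sqrt m : ℝ) : ℂ))⁻¹ = ((m : ℝ)⁻¹ : ℂ) := by
      rw [← mul_inv, ← Complex.ofReal_mul, Real.mul_self_sqrt (Nat.cast_nonneg m)]
    simp only [maxEntangled, Matrix.of_apply, Matrix.vecMulVec_apply, maxEntangledVec,
      Pi.star_apply, Matrix.smul_apply, Matrix.single_apply, smul_eq_mul]
    by_cases h1 : x = i <;> by_cases h2 : y = j <;> simp [h1, h2]
    simpa using hs
  rw [ampliate_apply, h, map_smul]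
  rfl

lemma posSemidef_maxEntangled (m : ℕ) : (maxEntangled m).PosSemidef :=
  Matrix.posSemidef_vecMulVec_self_star _

lemma star_maxEntangledVec_dotProduct {m : ℕ} (hm : 0 < m) :
    star (maxEntangledVec m) ⬝ᵥ maxEntangledVec m = 1 := by
  have hs : (((Real.sqrt m : ℝ) : ℂ))⁻¹ * (((Real.sqrt m : ℝ) : ℂ))⁻¹ = ((m : ℝ)⁻¹ : ℂ) := by
    rw [← mul_inv, ← Complex.ofReal_mul, Real.mul_self_sqrt (Nat.cast_nonneg m)]
  have h : ∀ x : Fin m × Fin m, star (maxEntangledVec m) x * maxEntangledVec m x =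
      if x.1 = x.2 then ((m : ℝ)⁻¹ : ℂ) else 0 := by
    intro x
    by_cases hx : x.1 = x.2 <;> simp [maxEntangledVec, hx]
    simpa using hs
  have hm' : (m : ℂ) ≠ 0 := by exact_mod_cast hm.ne'
  rw [dotProduct, Finset.sum_congr rfl fun x _ => h x]
  simp [Fintype.sum_prod_type, hm']

/-- The Choi matrix is m times the image of the maximally entangled state, so complete positivity
with a reference of dimension m suffices. For m = 0 there is no such state, but the matrix is empty.
-/
lemma posSemidef_choi {m : ℕ} {b : Type} {Φ : Matrix (Fin m) (Fin m) ℂ →ₗ[ℂ] Matrix b b ℂ}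
    (h : IsCompletelyPositive Φ) : (choi Φ).PosSemidef := by
  rcases Nat.eq_zero_or_pos m with rfl | hm
  · have : choi Φ = 0 := by ext ⟨x, _⟩; exact x.elim0
    rw [this]; exact Matrix.PosSemidef.zero
  · have h1 := (h m _ (posSemidef_maxEntangled m)).smul
      (show (0 : ℂ) ≤ ((m : ℝ) : ℂ) by exact_mod_cast Nat.zero_le m)
    rwa [ampliate_maxEntangled, smul_smul, mul_inv_cancel₀, one_smul] at h1
    exact_mod_cast hm.ne'

/-- The fidelity of a pure state with a state. -/
lemma fidelity_vecMulVec {a : Type} [Fintype a] [DecidableEq a] {v : a → ℂ}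
    (hv : star v ⬝ᵥ v = 1) {ρ : Matrix a a ℂ} (hρ : ρ.PosSemidef) :
    fidelity (Matrix.vecMulVec v (star v)) ρ = (star v ⬝ᵥ ρ *ᵥ v).re := by
  set P := Matrix.vecMulVec v (star v) with hP
  have hPpos : P.PosSemidef := Matrix.posSemidef_vecMulVec_self_star v
  have hPP : P * P = P := by
    rw [hP, Matrix.vecMulVec_mul_vecMulVec, hv]; simp
  have hsP : CFC.sqrt P = P := CFC.sqrt_unique hPP hPpos.nonneg
  have hs : (CFC.sqrt ρ)ᴴ = CFC.sqrt ρ :=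
    (Matrix.nonneg_iff_posSemidef.mp (CFC.sqrt_nonneg ρ)).isHermitian
  have hss : CFC.sqrt ρ * CFC.sqrt ρ = ρ := CFC.sqrt_mul_sqrt_self ρ hρ.nonneg
  have hc := hρ.dotProduct_mulVec_nonneg v
  set c := star v ⬝ᵥ ρ *ᵥ v with hcdef
  have hcre : ((c.re : ℝ) : ℂ) = c := by
    rw [Complex.nonneg_iff] at hc
    exact Complex.ext rfl hc.2
  have hc0 : 0 ≤ c.re := (Complex.nonneg_iff.mp hc).1
  -- Since P is the projection onto v, this product is P ρ P, a multiple of P, whose square root is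
  -- explicit.
  have hX : (P * CFC.sqrt ρ) * (P * CFC.sqrt ρ)ᴴ = c • P := by
    rw [Matrix.conjTranspose_mul, hs, hPpos.isHermitian.eq, Matrix.mul_assoc,
      ← Matrix.mul_assoc (CFC.sqrt ρ), hss, hP, Matrix.mul_vecMulVec, Matrix.vecMulVec_mul_vecMulVec]
    simp [hcdef, Matrix.vecMulVec_smul]
  have hsq : CFC.sqrt (c • P) = ((Real.sqrt c.re : ℝ) : ℂ) • P := by
    refine CFC.sqrt_unique ?_ ?_
    · rw [Matrix.smul_mul, Matrix.mul_smul, hPP, smul_smul, ← Complex.ofReal_mul,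
        Real.mul_self_sqrt hc0, hcre]
    · exact (hPpos.smul (by exact_mod_cast Real.sqrt_nonneg _)).nonneg
  have htr : P.trace = 1 := by rw [hP, Matrix.trace_vecMulVec, dotProduct_comm, hv]
  rw [fidelity, traceNorm, hsP, hX, hsq, Matrix.trace_smul, htr]
  simp [Real.sq_sqrt hc0]

lemma fidelity_maxEntangled {m : ℕ} (hm : 0 < m)
    {Φ : Matrix (Fin m) (Fin m) ℂ →ₗ[ℂ] Matrix (Fin m) (Fin m) ℂ} (h : IsCompletelyPositive Φ) :
    fidelity (maxEntangled m) (ampliate (Fin m) Φ (maxEntangled m)) = entFid Φ := by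
  have h0 := fidelity_vecMulVec (star_maxEntangledVec_dotProduct hm)
    (h m _ (posSemidef_maxEntangled m))
  rw [← maxEntangled] at h0
  rw [h0, ampliate_maxEntangled, Matrix.smul_mulVec,
    dotProduct_smul]
  have hs : (((Real.sqrt m : ℝ) : ℂ))⁻¹ * (((Real.sqrt m : ℝ) : ℂ))⁻¹ = ((m : ℝ)⁻¹ : ℂ) := by
    rw [← mul_inv, ← Complex.ofReal_mul, Real.mul_self_sqrt (Nat.cast_nonneg m)]
  have h1 : star (maxEntangledVec m) ⬝ᵥ choi Φ *ᵥ maxEntangledVec m =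
      ((m : ℝ)⁻¹ : ℂ) * ∑ x, ∑ y, Φ (Matrix.single x y 1) x y := by
    simp only [dotProduct, Matrix.mulVec, Fintype.sum_prod_type, maxEntangledVec, Pi.star_apply,
      choi, Matrix.of_apply, mul_ite, mul_zero, Finset.sum_ite_eq, Finset.mem_univ, if_true,
      apply_ite star, star_zero, ite_mul, zero_mul]
    rw [Finset.mul_sum]
    refine Finset.sum_congr rfl fun x _ => ?_
    rw [Finset.mul_sum, Finset.mul_sum]
    refine Finset.sum_congr rfl fun y _ => ?_
    rw [← hs]
    simp
    ring
  rw [h1, entFid, smul_eq_mul, ← mul_assoc, ← Complex.ofReal_inv, ← Complex.ofReal_mul,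
    Complex.re_ofReal_mul]
  field_simp

lemma entFid_sum_smul {m : ℕ} {ι : Type} (s : Finset ι) (t : ι → ℝ)
    (Φ : ι → Matrix (Fin m) (Fin m) ℂ →ₗ[ℂ] Matrix (Fin m) (Fin m) ℂ) :
    entFid (∑ i ∈ s, (t i : ℂ) • Φ i) = ∑ i ∈ s, t i * entFid (Φ i) := by
  simp only [entFid, LinearMap.sum_apply, LinearMap.smul_apply, Matrix.sum_apply,
    Matrix.smul_apply, smul_eq_mul, ← mul_div_assoc, ← Finset.sum_div]
  congr 1
  have h : ∑ x, ∑ y, ∑ i ∈ s, (t i : ℂ) * Φ i (Matrix.single x y 1) x y =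
      ∑ i ∈ s, (t i : ℂ) * ∑ x, ∑ y, Φ i (Matrix.single x y 1) x y := by
    simp only [Finset.mul_sum]
    rw [Finset.sum_comm]
    conv_rhs => rw [Finset.sum_comm]
    rw [Finset.sum_comm]
    exact Finset.sum_congr rfl fun x _ => Finset.sum_comm
  rw [h, Complex.re_sum]
  simp only [Complex.re_ofReal_mul]

lemma entFid_sum {m : ℕ} {ι : Type} (s : Finset ι)
    (Φ : ι → Matrix (Fin m) (Fin m) ℂ →ₗ[ℂ] Matrix (Fin m) (Fin m) ℂ) :
    entFid (∑ i ∈ s, Φ i) = ∑ i ∈ s, entFid (Φ i) := by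
  simpa using entFid_sum_smul s (fun _ => 1) Φ

/-- The double sum pairs the all-ones matrix with the principal submatrix of the Choi matrix at the
indices (x, x). -/
lemma entFid_nonneg {m : ℕ} {Φ : Matrix (Fin m) (Fin m) ℂ →ₗ[ℂ] Matrix (Fin m) (Fin m) ℂ}
    (h : IsCompletelyPositive Φ) : 0 ≤ entFid Φ := by
  have h1 := sum_mul_mem_Icc_of_posSemidef ((posSemidef_choi h).submatrix fun x : Fin m => (x, x))
    (Matrix.posSemidef_vecMulVec_self_star (fun _ : Fin m => (1 : ℂ)))
  refine div_nonneg ?_ (by positivity)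
  simpa [choi, Matrix.vecMulVec_apply] using h1.1

lemma entFid_conjBy {m : ℕ} (K : Matrix (Fin m) (Fin m) ℂ) :
    entFid (conjBy K) = Complex.normSq K.trace / (m : ℝ) ^ 2 := by
  rw [entFid]
  congr 1
  have : ∑ x, ∑ y, conjBy K (Matrix.single x y 1) x y = ((Complex.normSq K.trace : ℝ) : ℂ) := by
    rw [← Complex.mul_conj, Matrix.trace, map_sum, Finset.sum_mul_sum]
    refine Finset.sum_congr rfl fun x _ => Finset.sum_congr rfl fun y _ => ?_
    rw [conjBy_apply_apply, Finset.sum_eq_single x, Finset.sum_eq_single y]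
    · simp
    · intro j _ hj; simp [hj.symm]
    · simp
    · intro i _ hi; simp [hi.symm]
    · simp
  rw [this, Complex.ofReal_re]

/-- Measure-and-prepare maps have entanglement fidelity at most `1 / m`. -/
lemma entFid_le_of_measurePrepare {m : ℕ} (hm : 0 < m) {κ : Type} [Fintype κ]
    (ω : κ → Matrix (Fin m) (Fin m) ℂ →ₗ[ℂ] ℂ) (σ : κ → Matrix (Fin m) (Fin m) ℂ)
    {Φ : Matrix (Fin m) (Fin m) ℂ →ₗ[ℂ] Matrix (Fin m) (Fin m) ℂ}
    (hω : ∀ r, (Matrix.of fun x y => ω r (Matrix.single x y 1)).PosSemidef)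
    (hσ : ∀ r, (σ r).PosSemidef) (hΦ : ∀ X, Φ X = ∑ r, ω r X • σ r)
    (htr : ∀ X, (Φ X).trace = X.trace) : entFid Φ ≤ 1 / m := by
  have hm' : (0 : ℝ) < m := by exact_mod_cast hm
  have hre : ∀ {A : Matrix (Fin m) (Fin m) ℂ}, A.PosSemidef → ((A.trace.re : ℝ) : ℂ) = A.trace :=
    fun hA => Complex.ext rfl (Complex.nonneg_iff.mp hA.trace_nonneg).2
  -- The fidelity splits into one Hilbert–Schmidt pairing per outcome, each at most a product of two
  -- traces. By trace preservation these products add up to the trace of Φ(1), which is m.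
  have h1 : ∑ x, ∑ y, Φ (Matrix.single x y 1) x y =
      ∑ r, ∑ x, ∑ y, (Matrix.of fun x y => ω r (Matrix.single x y 1)) x y * σ r x y := by
    simp only [hΦ, Matrix.sum_apply, Matrix.smul_apply, smul_eq_mul, Matrix.of_apply]
    conv_rhs => rw [Finset.sum_comm]
    exact Finset.sum_congr rfl fun x _ => Finset.sum_comm
  have h2 : ((∑ r, (Matrix.of fun x y => ω r (Matrix.single x y 1)).trace.re * (σ r).trace.re : ℝ)
      : ℂ) = m := by
    push_cast
    simp only [hre (hω _), hre (hσ _)]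
    calc _ = ∑ x, ∑ r, ω r (Matrix.single x x 1) * (σ r).trace := by
          simp only [Matrix.trace, Matrix.diag_apply, Matrix.of_apply, Finset.sum_mul]
          exact Finset.sum_comm
      _ = ∑ x : Fin m, (Φ (Matrix.single x x 1)).trace := by
          simp [hΦ, Matrix.trace_sum, Matrix.trace_smul]
      _ = m := by simp [htr]
  have h3 : (∑ x, ∑ y, Φ (Matrix.single x y 1) x y).re ≤ m := by
    rw [h1, Complex.re_sum]
    have h2' := congrArg Complex.re h2
    rw [Complex.ofReal_re, Complex.natCast_re] at h2'
    rw [← h2']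
    exact Finset.sum_le_sum fun r _ => (sum_mul_mem_Icc_of_posSemidef (hω r) (hσ r)).2
  rw [entFid, div_le_div_iff₀ (by positivity) hm']
  nlinarith

/-- The same pairing as for nonnegativity, bounded by the product of traces: the all-ones matrix has
trace m, and the Choi submatrix has m diagonal entries, each at most 1. -/
lemma entFid_le_one {m : ℕ} (hm : 0 < m)
    {Φ : Matrix (Fin m) (Fin m) ℂ →ₗ[ℂ] Matrix (Fin m) (Fin m) ℂ} (h : IsChannel Φ) :
    entFid Φ ≤ 1 := by
  have hm' : (0 : ℝ) < m := by exact_mod_cast hm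
  have h1 := sum_mul_mem_Icc_of_posSemidef
    ((posSemidef_choi h.1).submatrix fun x : Fin m => (x, x))
    (Matrix.posSemidef_vecMulVec_self_star (fun _ : Fin m => (1 : ℂ)))
  have h2 : ((choi Φ).submatrix (fun x : Fin m => (x, x)) fun x : Fin m => (x, x)).trace.re ≤
      m := by
    have h3 : ∀ x : Fin m, (Φ (Matrix.single x x 1) x x).re ≤ 1 := by
      intro x
      have h4 : ∑ k, (Φ (Matrix.single x x 1) k k).re = 1 := by
        have := congrArg Complex.re (h.2 (Matrix.single x x 1))
        simpa [Matrix.trace] using this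
      rw [← h4]
      refine Finset.single_le_sum (f := fun k => (Φ (Matrix.single x x 1) k k).re) (fun k _ => ?_)
        (Finset.mem_univ x)
      exact (Complex.nonneg_iff.mp ((posSemidef_choi h.1).diag_nonneg (i := (x, k)))).1
    rw [Matrix.trace, Complex.re_sum]
    calc _ ≤ ∑ x : Fin m, (1 : ℝ) := Finset.sum_le_sum fun x _ => h3 x
      _ = m := by simp
  have h5 := h1.2
  simp only [Matrix.submatrix_apply, choi, Matrix.of_apply, Matrix.vecMulVec_apply, Pi.star_apply,
    star_one, mul_one] at h5
  rw [entFid, div_le_one (by positivity)]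
  refine h5.trans ?_
  have h6 : (Matrix.vecMulVec (fun _ : Fin m => (1 : ℂ)) (star fun _ : Fin m => (1 : ℂ))).trace.re
      = m := by simp [Matrix.trace, Matrix.vecMulVec_apply]
  rw [h6, sq]
  exact mul_le_mul_of_nonneg_right h2 hm'.le

/-! ### Tensor powers of channels in Kraus form -/

/-- The tensor product of `n` matrices. -/
def tens {a b : Type} {n : ℕ} (A : Fin n → Matrix b a ℂ) : Matrix (Fin n → b) (Fin n → a) ℂ :=
  Matrix.of fun k i => ∏ t, A t (k t) (i t)

section Tens

variable {a b c : Type} {n : ℕ}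

lemma tens_mul [Fintype b] (A : Fin n → Matrix c b ℂ) (B : Fin n → Matrix b a ℂ) :
    tens A * tens B = tens fun t => A t * B t := by
  ext k i
  simp only [tens, Matrix.mul_apply, Matrix.of_apply, Finset.prod_univ_sum,
    Fintype.piFinset_univ, Finset.prod_mul_distrib]

lemma tens_one [Fintype a] [DecidableEq a] :
    tens (fun _ : Fin n => (1 : Matrix a a ℂ)) = 1 := by
  ext k i
  simp only [tens, Matrix.of_apply, Matrix.one_apply, Finset.prod_ite_zero, Finset.prod_const_one,
    funext_iff, Finset.mem_univ, true_implies]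

lemma conjTranspose_tens (A : Fin n → Matrix b a ℂ) : (tens A)ᴴ = tens fun t => (A t)ᴴ := by
  ext k i
  simp [tens, Matrix.conjTranspose_apply]

/-- Expanding the product over positions turns a mixture of single-letter errors into an i.i.d.
mixture of words of errors. All later arguments use the channels in this form. -/
lemma tensorPow_sum_conjBy {S : Type} [Fintype S] [Fintype a] [DecidableEq a]
    (p : S → ℝ) (K : S → Matrix b a ℂ) (n : ℕ) :
    tensorPow (∑ s, (p s : ℂ) • conjBy (K s)) n =
      ∑ s : Fin n → S, (iidPow n p s : ℂ) • conjBy (tens fun t => K (s t)) := by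
  have hN : ∀ (i j : a) (k l : b), (∑ s, (p s : ℂ) • conjBy (K s)) (Matrix.single i j 1) k l =
      ∑ s, (p s : ℂ) * (K s k i * star (K s l j)) := by
    intro i j k l
    simp only [LinearMap.sum_apply, LinearMap.smul_apply, Matrix.sum_apply, Matrix.smul_apply,
      smul_eq_mul]
    refine Finset.sum_congr rfl fun s _ => ?_
    rw [conjBy_apply_apply, Finset.sum_eq_single i, Finset.sum_eq_single j]
    · simp
    · intro j' _ hj; simp [hj.symm]
    · simp
    · intro i' _ hi; simp [hi.symm]
    · simp
  refine LinearMap.ext fun X => ?_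
  ext k l
  simp only [tensorPow, LinearMap.coe_mk, AddHom.coe_mk, Matrix.of_apply, hN,
    LinearMap.sum_apply, LinearMap.smul_apply, Matrix.sum_apply, Matrix.smul_apply, smul_eq_mul,
    conjBy_apply_apply, Finset.prod_univ_sum, Fintype.piFinset_univ, Finset.mul_sum]
  calc _ = ∑ i, ∑ s : Fin n → S, ∑ j, X i j * ∏ t, (p (s t) : ℂ) *
          (K (s t) (k t) (i t) * star (K (s t) (l t) (j t))) :=
        Finset.sum_congr rfl fun i _ => Finset.sum_comm
    _ = ∑ s : Fin n → S, ∑ i, ∑ j, X i j * ∏ t, (p (s t) : ℂ) *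
          (K (s t) (k t) (i t) * star (K (s t) (l t) (j t))) := Finset.sum_comm
    _ = _ := by
        refine Finset.sum_congr rfl fun s _ => Finset.sum_congr rfl fun i _ =>
          Finset.sum_congr rfl fun j _ => ?_
        simp only [tens, Matrix.of_apply, iidPow, Finset.prod_mul_distrib, Complex.ofReal_prod,
          star_prod]
        ring

lemma iidPow_nonneg {S : Type} {p : S → ℝ} (hp : ∀ s, 0 ≤ p s) (s : Fin n → S) :
    0 ≤ iidPow n p s := Finset.prod_nonneg fun _ _ => hp _

lemma sum_iidPow {S : Type} [Fintype S] (p : S → ℝ) (n : ℕ) :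
    ∑ s, iidPow n p s = (∑ s, p s) ^ n := by
  simp only [iidPow]
  rw [← Fintype.piFinset_univ, ← Finset.prod_univ_sum (fun _ => Finset.univ) fun _ s => p s]
  simp

lemma isCompletelyPositive_tensorPow {S : Type} [Fintype S] [Fintype a] [DecidableEq a]
    [Fintype b] {p : S → ℝ} (hp : ∀ s, 0 ≤ p s) (K : S → Matrix b a ℂ) (n : ℕ) :
    IsCompletelyPositive (tensorPow (∑ s, (p s : ℂ) • conjBy (K s)) n) := by
  rw [tensorPow_sum_conjBy]
  exact isCompletelyPositive_sum _ fun s _ =>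
    (isCompletelyPositive_conjBy _).smul (iidPow_nonneg hp s)

lemma isCompletelyPositive_ampliate_tensorPow {S : Type} [Fintype S] [Fintype a] [DecidableEq a]
    [Fintype b] {p : S → ℝ} (hp : ∀ s, 0 ≤ p s) (K : S → Matrix b a ℂ) (n q : ℕ) :
    IsCompletelyPositive (ampliate (Fin q) (tensorPow (∑ s, (p s : ℂ) • conjBy (K s)) n)) := by
  rw [tensorPow_sum_conjBy, ampliate_sum]
  refine isCompletelyPositive_sum _ fun s _ => ?_
  rw [ampliate_smul, ampliate_conjBy]
  exact (isCompletelyPositive_conjBy _).smul (iidPow_nonneg hp s)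

end Tens

/-! ### Dephasing and depolarizing channels as mixtures -/

/-- The distribution of a bit that is nonzero with probability `γ`. -/
def bern (γ : ℝ) (s : Fin 2) : ℝ := if s = 0 then 1 - γ else γ

/-- The powers of the Pauli operator `Z`. -/
def phaseOp (s : Fin 2) : Matrix (Fin 2) (Fin 2) ℂ := if s = 0 then 1 else pauliZ

lemma bern_nonneg {γ : ℝ} (h : γ ∈ Set.Icc (0 : ℝ) 1) (s : Fin 2) : 0 ≤ bern γ s := by
  unfold bern; split_ifs <;> linarith [h.1, h.2]

lemma sum_bern (γ : ℝ) : ∑ s, bern γ s = 1 := by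
  simp [bern]

lemma sum_iidPow_bern (γ : ℝ) (n : ℕ) : ∑ s, iidPow n (bern γ) s = 1 := by
  rw [sum_iidPow, sum_bern, one_pow]

lemma iidPow_bern_half (n : ℕ) (s : Fin n → Fin 2) : iidPow n (bern (1 / 2)) s = (1 / 2) ^ n := by
  have : ∀ s, bern (1 / 2) s = 1 / 2 := fun s => by unfold bern; split_ifs <;> norm_num
  simp only [iidPow, this, Finset.prod_const, Finset.card_univ, Fintype.card_fin]

lemma conjTranspose_pauliZ : pauliZᴴ = pauliZ := by
  ext i j; fin_cases i <;> fin_cases j <;> simp [pauliZ]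

lemma conjTranspose_phaseOp (s : Fin 2) : (phaseOp s)ᴴ = phaseOp s := by
  unfold phaseOp; split_ifs <;> simp [conjTranspose_pauliZ]

lemma phaseOp_mul_self (s : Fin 2) : phaseOp s * phaseOp s = 1 := by
  unfold phaseOp; split_ifs
  · simp
  · ext i j; fin_cases i <;> fin_cases j <;> simp [pauliZ]

lemma dephasing_eq (γ : ℝ) : dephasing γ = ∑ s, (bern γ s : ℂ) • conjBy (phaseOp s) := by
  refine LinearMap.ext fun X => ?_
  simp [dephasing, bern, phaseOp, conjBy_apply, conjTranspose_pauliZ]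

/-- The dephasing error operator of an error pattern. -/
def phaseErr {n : ℕ} (s : Fin n → Fin 2) : Matrix (Fin n → Fin 2) (Fin n → Fin 2) ℂ :=
  tens fun t => phaseOp (s t)

lemma conjTranspose_phaseErr {n : ℕ} (s : Fin n → Fin 2) : (phaseErr s)ᴴ = phaseErr s := by
  simp only [phaseErr, conjTranspose_tens, conjTranspose_phaseOp]

lemma phaseErr_mul_self {n : ℕ} (s : Fin n → Fin 2) : phaseErr s * phaseErr s = 1 := by
  simp only [phaseErr, tens_mul, phaseOp_mul_self, tens_one]

lemma tensorPow_dephasing (γ : ℝ) (n : ℕ) :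
    tensorPow (dephasing γ) n = ∑ s, (iidPow n (bern γ) s : ℂ) • conjBy (phaseErr s) := by
  rw [dephasing_eq, tensorPow_sum_conjBy]
  rfl

/-- At noise 1/2 all coherences vanish, so the channel is a measurement in the computational basis.
It is the useless reference channel of the converse. -/
lemma tensorPow_dephasing_half (n : ℕ) (X : Matrix (Fin n → Fin 2) (Fin n → Fin 2) ℂ)
    (k l : Fin n → Fin 2) :
    tensorPow (dephasing (1 / 2)) n X k l = if k = l then X k l else 0 := by
  have h : ∀ i j k l : Fin 2, dephasing (1 / 2) (Matrix.single i j 1) k l =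
      if i = k ∧ j = l ∧ k = l then 1 else 0 := by
    intro i j k l
    simp only [dephasing, LinearMap.coe_mk, AddHom.coe_mk, Matrix.add_apply, Matrix.smul_apply,
      Matrix.mul_apply, Fin.sum_univ_two, Matrix.single_apply]
    fin_cases i <;> fin_cases j <;> fin_cases k <;> fin_cases l <;> simp [pauliZ] <;> norm_num
  have h2 : ∀ i j : Fin n → Fin 2, ∏ t, dephasing (1 / 2) (Matrix.single (i t) (j t) 1) (k t) (l t)
      = if i = k then (if j = l then (if k = l then 1 else 0) else 0) else 0 := by
    intro i j
    simp only [h, Finset.prod_ite_zero, Finset.mem_univ, true_implies, Finset.prod_const_one]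
    simp only [← ite_and]
    refine if_congr ?_ rfl rfl
    simp only [funext_iff, forall_and]
  simp only [tensorPow, LinearMap.coe_mk, AddHom.coe_mk, Matrix.of_apply, h2]
  simp

/-- Unitaries that rotate the dephasing channel into the Pauli `Z`, `X` and `Y` channels. -/
def axisRot : Fin 3 → Matrix (Fin 2) (Fin 2) ℂ :=
  ![1, ((Real.sqrt 2)⁻¹ : ℂ) • (pauliX + pauliZ), ((Real.sqrt 2)⁻¹ : ℂ) • (pauliY + pauliZ)]

lemma inv_sqrt_two_mul_self : (((Real.sqrt 2 : ℝ) : ℂ))⁻¹ * (((Real.sqrt 2 : ℝ) : ℂ))⁻¹ = 1 / 2 := by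
  rw [← mul_inv, ← Complex.ofReal_mul, Real.mul_self_sqrt (by norm_num)]
  norm_num

lemma conjTranspose_axisRot (i : Fin 3) : (axisRot i)ᴴ = axisRot i := by
  fin_cases i <;> ext k l <;> fin_cases k <;> fin_cases l <;>
    simp [axisRot, pauliX, pauliY, pauliZ]

lemma axisRot_mul_self (i : Fin 3) : axisRot i * axisRot i = 1 := by
  have h := inv_sqrt_two_mul_self
  fin_cases i
  · simp [axisRot]
  · simp only [axisRot]
    ext k l; fin_cases k <;> fin_cases l <;>
    simp [pauliX, pauliZ, Matrix.mul_apply] <;>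
    linear_combination 2 * h
  · simp only [axisRot]
    ext k l; fin_cases k <;> fin_cases l <;>
    simp [pauliY, pauliZ, Matrix.mul_apply] <;>
    first
    | linear_combination (1 - Complex.I ^ 2) * h - 1 / 2 * Complex.I_sq
    | ring

/-- The Pauli operators `Z`, `X`, `Y`. -/
def pauli : Fin 3 → Matrix (Fin 2) (Fin 2) ℂ := ![pauliZ, pauliX, pauliY]

lemma axisRot_mul_pauliZ_mul (i : Fin 3) : axisRot i * pauliZ * axisRot i = pauli i := by
  have h := inv_sqrt_two_mul_self
  fin_cases i
  · simp [axisRot, pauli]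
  · simp only [axisRot, pauli]
    ext k l; fin_cases k <;> fin_cases l <;>
    simp [pauliX, pauliZ, Matrix.mul_apply] <;>
    linear_combination 2 * h
  · simp only [axisRot, pauli]
    ext k l; fin_cases k <;> fin_cases l <;>
    simp [pauliY, pauliZ, Matrix.mul_apply] <;>
    first
    | linear_combination -2 * Complex.I * h
    | linear_combination 2 * Complex.I * h
    | linear_combination (((Real.sqrt 2 : ℝ) : ℂ))⁻¹ ^ 2 * Complex.I_sq
    | linear_combination -(((Real.sqrt 2 : ℝ) : ℂ))⁻¹ ^ 2 * Complex.I_sq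

lemma conjTranspose_pauli (i : Fin 3) : (pauli i)ᴴ = pauli i := by
  fin_cases i <;> ext k l <;> fin_cases k <;> fin_cases l <;>
    simp [pauli, pauliX, pauliY, pauliZ]

/-- A uniformly random axis turns the error Z into a uniformly random Pauli error. The identity is
kept once per axis, so that the label is an independent pair (axis, error bit) and the axis can be
averaged out separately. -/
lemma depolarizing_eq (α : ℝ) : depolarizing α =
    ∑ s : Fin 3 × Fin 2, ((1 / 3 * bern α s.2 : ℝ) : ℂ) •
      conjBy (axisRot s.1 * phaseOp s.2 * axisRot s.1) := by
  refine LinearMap.ext fun X => ?_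
  have h0 : ∀ i, axisRot i * phaseOp 0 * axisRot i = 1 := fun i => by
    simp [phaseOp, axisRot_mul_self]
  have h1 : ∀ i, axisRot i * phaseOp 1 * axisRot i = pauli i := fun i => by
    simp [phaseOp, axisRot_mul_pauliZ_mul]
  rw [LinearMap.sum_apply, Fintype.sum_prod_type]
  simp only [Fin.sum_univ_two, h0, h1, LinearMap.smul_apply, conjBy_apply, conjTranspose_pauli]
  simp only [Fin.sum_univ_three, depolarizing, LinearMap.coe_mk, AddHom.coe_mk]
  have e0 : pauli 0 = pauliZ := rfl
  have e1 : pauli 1 = pauliX := rfl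
  have e2 : pauli 2 = pauliY := rfl
  rw [e0, e1, e2]
  simp only [bern, if_true, one_ne_zero, if_false, Matrix.conjTranspose_one, Matrix.one_mul,
    Matrix.mul_one]
  push_cast
  module

/-- The rotation of `n` qubits by single-qubit rotations. -/
def wordRot {n : ℕ} (i : Fin n → Fin 3) : Matrix (Fin n → Fin 2) (Fin n → Fin 2) ℂ :=
  tens fun t => axisRot (i t)

lemma conjTranspose_wordRot {n : ℕ} (i : Fin n → Fin 3) : (wordRot i)ᴴ = wordRot i := by
  simp only [wordRot, conjTranspose_tens, conjTranspose_axisRot]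

lemma wordRot_mul_self {n : ℕ} (i : Fin n → Fin 3) : wordRot i * wordRot i = 1 := by
  simp only [wordRot, tens_mul, axisRot_mul_self, tens_one]

/-- The depolarizing channel is a uniform mixture of rotated dephasing channels. -/
lemma tensorPow_depolarizing (α : ℝ) (n : ℕ) :
    tensorPow (depolarizing α) n = ∑ i : Fin n → Fin 3, (((1 / 3) ^ n : ℝ) : ℂ) •
      (conjBy (wordRot i) ∘ₗ tensorPow (dephasing α) n ∘ₗ conjBy (wordRot i)) := by
  rw [depolarizing_eq, tensorPow_sum_conjBy fun s : Fin 3 × Fin 2 => 1 / 3 * bern α s.2,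
    ← (Equiv.arrowProdEquivProdArrow (Fin n) (fun _ => Fin 3) (fun _ => Fin 2)).symm.sum_comp,
    Fintype.sum_prod_type]
  refine Finset.sum_congr rfl fun i _ => ?_
  rw [tensorPow_dephasing]
  refine LinearMap.ext fun X => ?_
  simp only [LinearMap.sum_apply, LinearMap.smul_apply, LinearMap.comp_apply, map_sum, map_smul,
    Finset.smul_sum, smul_smul]
  refine Finset.sum_congr rfl fun s _ => ?_
  congr 1
  · rw [← Complex.ofReal_mul]
    congr 1
    simp [iidPow, Finset.prod_mul_distrib, Equiv.arrowProdEquivProdArrow]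
  · rw [← LinearMap.comp_apply, ← LinearMap.comp_apply, conjBy_comp, conjBy_comp, wordRot,
      phaseErr, tens_mul, tens_mul]
    rfl

/-! ### LOCC channels -/

/-- LOCC channels have product Kraus operators. -/
lemma IsLOCC.exists_kraus {c d : Type} [Fintype c] [Fintype d] [DecidableEq c] [DecidableEq d]
    {a b : Type} {Φ : Matrix (a × b) (a × b) ℂ →ₗ[ℂ] Matrix (c × d) (c × d) ℂ} (h : IsLOCC Φ) :
    ∀ (_ : Fintype a) (_ : Fintype b), (∀ X, (Φ X).trace = X.trace) ∧
      ∃ (κ : Type) (_ : Fintype κ) (A : κ → Matrix c a ℂ) (B : κ → Matrix d b ℂ),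
        Φ = ∑ r, conjBy (A r ⊗ₖ B r) := by
  -- The instances on `a` and `b` are quantified because the systems change from round to round.
  -- Trace preservation is carried along since it also follows round by round.
  induction h with
  | done =>
    intro fa fb
    refine ⟨fun X => by simp only [LinearMap.id_apply]; congr!, Unit, inferInstance,
      fun _ => 1, fun _ => 1, ?_⟩
    refine LinearMap.ext fun X => ?_
    simp only [Finset.univ_unique, Finset.sum_singleton, Matrix.one_kronecker_one]
    ext x y
    rw [conjBy_apply_apply]
    simp [Matrix.one_apply]
  | @alice a b a' ι fa da fb db fa' fι K hK Φ hΦ ih =>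
    intro fa2 fb2
    obtain rfl := Subsingleton.elim fa fa2
    obtain rfl := Subsingleton.elim fb fb2
    have h := fun i => ih i fa' fb
    refine ⟨fun X => ?_, ?_⟩
    · rw [LinearMap.sum_apply, Matrix.trace_sum]
      simp only [LinearMap.comp_apply, (h _).1, trace_conjBy]
      rw [← Matrix.trace_sum, ← Finset.sum_mul]
      have : ∑ i, (K i ⊗ₖ (1 : Matrix b b ℂ))ᴴ * (K i ⊗ₖ (1 : Matrix b b ℂ)) = 1 := by
        simp only [Matrix.conjTranspose_kronecker, ← Matrix.mul_kronecker_mul,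
          Matrix.conjTranspose_one, Matrix.one_mul]
        rw [← Matrix.one_kronecker_one, ← hK]
        ext x y
        simp [Matrix.kroneckerMap_apply, Matrix.sum_apply, Finset.sum_mul]
      rw [this, Matrix.one_mul]
    · choose κ fκ A B hAB using fun i => (h i).2
      refine ⟨Σ i, κ i, inferInstance, fun r => A r.1 r.2 * K r.1, fun r => B r.1 r.2, ?_⟩
      rw [Fintype.sum_sigma]
      refine Finset.sum_congr rfl fun i _ => ?_
      rw [hAB i]
      refine LinearMap.ext fun X => ?_
      simp only [LinearMap.comp_apply, LinearMap.sum_apply]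
      refine Finset.sum_congr rfl fun r _ => ?_
      rw [← LinearMap.comp_apply, conjBy_comp, ← Matrix.mul_kronecker_mul, Matrix.mul_one]
  | @bob a b b' ι fa da fb db fb' fι K hK Φ hΦ ih =>
    intro fa2 fb2
    obtain rfl := Subsingleton.elim fa fa2
    obtain rfl := Subsingleton.elim fb fb2
    have h := fun i => ih i fa fb'
    refine ⟨fun X => ?_, ?_⟩
    · rw [LinearMap.sum_apply, Matrix.trace_sum]
      simp only [LinearMap.comp_apply, (h _).1, trace_conjBy]
      rw [← Matrix.trace_sum, ← Finset.sum_mul]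
      have : ∑ i, ((1 : Matrix a a ℂ) ⊗ₖ K i)ᴴ * ((1 : Matrix a a ℂ) ⊗ₖ K i) = 1 := by
        simp only [Matrix.conjTranspose_kronecker, ← Matrix.mul_kronecker_mul,
          Matrix.conjTranspose_one, Matrix.one_mul]
        rw [← Matrix.one_kronecker_one, ← hK]
        ext x y
        simp [Matrix.kroneckerMap_apply, Matrix.sum_apply, Finset.mul_sum]
      rw [this, Matrix.one_mul]
    · choose κ fκ A B hAB using fun i => (h i).2
      refine ⟨Σ i, κ i, inferInstance, fun r => A r.1 r.2, fun r => B r.1 r.2 * K r.1, ?_⟩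
      rw [Fintype.sum_sigma]
      refine Finset.sum_congr rfl fun i _ => ?_
      rw [hAB i]
      refine LinearMap.ext fun X => ?_
      simp only [LinearMap.comp_apply, LinearMap.sum_apply]
      refine Finset.sum_congr rfl fun r _ => ?_
      rw [← LinearMap.comp_apply, conjBy_comp, ← Matrix.mul_kronecker_mul, Matrix.mul_one]

lemma dropTrivial_apply {d : Type} (X : Matrix (Unit × d) (Unit × d) ℂ) (i j : d) :
    dropTrivial d X i j = X ((), i) ((), j) := rfl

/-- Alice ends with a one-dimensional system, so her factor of each product Kraus operator is a row
vector. This is the only feature of LOCC that the converse uses. -/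
lemma IsLOCCToBob.exists_kraus {a b d : Type} [Fintype a] [Fintype b] [Fintype d] [DecidableEq d]
    {D : Matrix (a × b) (a × b) ℂ →ₗ[ℂ] Matrix d d ℂ} (h : IsLOCCToBob D) :
    (∀ X, (D X).trace = X.trace) ∧
      ∃ (κ : Type) (_ : Fintype κ) (A : κ → a → ℂ) (B : κ → Matrix d b ℂ),
        D = ∑ r, conjBy (Matrix.of fun j x => A r x.1 * B r j x.2) := by
  obtain ⟨Φ, hΦ, rfl⟩ := h
  obtain ⟨htr, κ, fκ, A, B, rfl⟩ := hΦ.exists_kraus inferInstance inferInstance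
  refine ⟨fun X => ?_, κ, fκ, fun r => A r (), B, ?_⟩
  · rw [← htr X]
    simp only [Matrix.trace, Matrix.diag_apply, LinearMap.comp_apply, dropTrivial_apply,
      Fintype.sum_prod_type, Finset.univ_unique, Finset.sum_singleton]
  · refine LinearMap.ext fun X => ?_
    ext j l
    simp only [LinearMap.comp_apply, dropTrivial_apply, LinearMap.sum_apply, Matrix.sum_apply,
      conjBy_apply_apply, Matrix.kroneckerMap_apply, Matrix.of_apply]

lemma IsLOCCToBob.isChannel {a b d : Type} [Fintype a] [Fintype b] [Fintype d] [DecidableEq d]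
    {D : Matrix (a × b) (a × b) ℂ →ₗ[ℂ] Matrix d d ℂ} (h : IsLOCCToBob D) : IsChannel D := by
  obtain ⟨htr, κ, _, A, B, hD⟩ := h.exists_kraus
  refine ⟨?_, htr⟩
  rw [hD]
  exact isCompletelyPositive_sum _ fun r _ => isCompletelyPositive_conjBy _

/-- Bob may apply a local isometry before an LOCC channel. -/
lemma IsLOCCToBob.comp_conjBy {a b b' d : Type} [Fintype a] [DecidableEq a] [Fintype b]
    [DecidableEq b] [Fintype b'] {D : Matrix (a × b') (a × b') ℂ →ₗ[ℂ] Matrix d d ℂ}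
    (h : IsLOCCToBob D) {K : Matrix b' b ℂ} (hK : Kᴴ * K = 1) :
    IsLOCCToBob (D ∘ₗ conjBy ((1 : Matrix a a ℂ) ⊗ₖ K)) := by
  obtain ⟨Φ, hΦ, rfl⟩ := h
  refine ⟨Φ ∘ₗ conjBy ((1 : Matrix a a ℂ) ⊗ₖ K), ?_, rfl⟩
  simpa using IsLOCC.bob (fun _ : Unit => K) (by simpa using hK) (fun _ => Φ) (fun _ => hΦ)

/-! ### Codes -/

/-- `m` is the size of an entanglement transmission code for `N^{⊗ n}` with error `ε`. -/
def IsCode {a b : Type} [Fintype a] [DecidableEq a] [Fintype b]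
    (N : Matrix a a ℂ →ₗ[ℂ] Matrix b b ℂ) (n : ℕ) (ε : ℝ) (m : ℕ) : Prop :=
  ∃ (E : Matrix (Fin m) (Fin m) ℂ →ₗ[ℂ] Matrix (Fin n → a) (Fin n → a) ℂ)
    (D : Matrix (Fin n → b) (Fin n → b) ℂ →ₗ[ℂ] Matrix (Fin m) (Fin m) ℂ),
    IsChannel E ∧ IsChannel D ∧ 1 - ε ≤ entFid (D ∘ₗ tensorPow N n ∘ₗ E)

/-- `m` is the size of a code for `N^{⊗ n}`, assisted by classical post-processing, with
error `ε`. -/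
def IsCppCode {a b : Type} [Fintype a] [DecidableEq a] [Fintype b]
    (N : Matrix a a ℂ →ₗ[ℂ] Matrix b b ℂ) (n : ℕ) (ε : ℝ) (m : ℕ) : Prop :=
  ∃ (q : ℕ)
    (E : Matrix (Fin m) (Fin m) ℂ →ₗ[ℂ] Matrix (Fin q × (Fin n → a)) (Fin q × (Fin n → a)) ℂ)
    (D : Matrix (Fin q × (Fin n → b)) (Fin q × (Fin n → b)) ℂ →ₗ[ℂ] Matrix (Fin m) (Fin m) ℂ),
    IsChannel E ∧ IsLOCCToBob D ∧
      1 - ε ≤ entFid (D ∘ₗ ampliate (Fin q) (tensorPow N n) ∘ₗ E)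

section Achievable

variable {a b S : Type} [Fintype a] [DecidableEq a] [Fintype b] [DecidableEq b] [Fintype S]
  {p : S → ℝ} {K : S → Matrix b a ℂ} {N : Matrix a a ℂ →ₗ[ℂ] Matrix b b ℂ}

lemma achievable_iff (hp : ∀ s, 0 ≤ p s) (hN : N = ∑ s, (p s : ℂ) • conjBy (K s)) {R : ℝ} {n : ℕ}
    {ε : ℝ} : Achievable N R n ε ↔
      ∃ m : ℕ, (0 < m ∧ IsCode N n ε m) ∧ R ≤ 1 / (n : ℝ) * Real.logb 2 m := by
  subst hN
  constructor
  · rintro ⟨m, E, D, hm, hE, hD, hR, hF⟩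
    rw [fidelity_maxEntangled hm
      (hD.1.comp ((isCompletelyPositive_tensorPow hp K n).comp hE.1))] at hF
    exact ⟨m, ⟨hm, E, D, hE, hD, hF⟩, hR⟩
  · rintro ⟨m, ⟨hm, E, D, hE, hD, hF⟩, hR⟩
    refine ⟨m, E, D, hm, hE, hD, hR, ?_⟩
    rwa [fidelity_maxEntangled hm (hD.1.comp ((isCompletelyPositive_tensorPow hp K n).comp hE.1))]

lemma achievableCpp_iff (hp : ∀ s, 0 ≤ p s) (hN : N = ∑ s, (p s : ℂ) • conjBy (K s)) {R : ℝ}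
    {n : ℕ} {ε : ℝ} : AchievableCpp N R n ε ↔
      ∃ m : ℕ, (0 < m ∧ IsCppCode N n ε m) ∧ R ≤ 1 / (n : ℝ) * Real.logb 2 m := by
  subst hN
  constructor
  · rintro ⟨m, q, E, D, hm, hE, hD, hR, hF⟩
    rw [fidelity_maxEntangled hm (hD.isChannel.1.comp
      ((isCompletelyPositive_ampliate_tensorPow hp K n q).comp hE.1))] at hF
    exact ⟨m, ⟨hm, q, E, D, hE, hD, hF⟩, hR⟩
  · rintro ⟨m, ⟨hm, q, E, D, hE, hD, hF⟩, hR⟩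
    refine ⟨m, q, E, D, hm, hE, hD, hR, ?_⟩
    rwa [fidelity_maxEntangled hm (hD.isChannel.1.comp
      ((isCompletelyPositive_ampliate_tensorPow hp K n q).comp hE.1))]

end Achievable

/-! ### From the depolarizing to the dephasing channel -/

lemma exists_le_of_le_sum_uniform {n : ℕ} {f : (Fin n → Fin 3) → ℝ} {t : ℝ}
    (h : t ≤ ∑ i, (1 / 3) ^ n * f i) : ∃ i, t ≤ f i := by
  by_contra! hc
  have h1 : ∑ i : Fin n → Fin 3, (1 / 3 : ℝ) ^ n * f i <
      ∑ i : Fin n → Fin 3, (1 / 3 : ℝ) ^ n * t :=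
    Finset.sum_lt_sum_of_nonempty Finset.univ_nonempty fun i _ => by
      have := hc i
      gcongr
  have h2 : ∑ i : Fin n → Fin 3, (1 / 3 : ℝ) ^ n * t = t := by
    rw [Finset.sum_const, Finset.card_univ, Fintype.card_fun, nsmul_eq_mul]
    simp
  linarith

/-- The rotations before and after the dephasing are absorbed in encoder and decoder. The fidelity
is then the mean over 3^n dephasing codes, and the best of them reaches the mean. -/
lemma IsCode.dephasing_of_depolarizing {α ε : ℝ} {n m : ℕ}
    (h : IsCode (depolarizing α) n ε m) : IsCode (dephasing α) n ε m := by
  obtain ⟨E, D, hE, hD, hF⟩ := h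
  have hsum : D ∘ₗ tensorPow (depolarizing α) n ∘ₗ E =
      ∑ i : Fin n → Fin 3, (((1 / 3) ^ n : ℝ) : ℂ) • ((D ∘ₗ conjBy (wordRot i)) ∘ₗ
        tensorPow (dephasing α) n ∘ₗ (conjBy (wordRot i) ∘ₗ E)) := by
    rw [tensorPow_depolarizing]
    refine LinearMap.ext fun X => ?_
    simp [LinearMap.sum_apply, map_sum]
  rw [hsum, entFid_sum_smul] at hF
  obtain ⟨i, hi⟩ := exists_le_of_le_sum_uniform hF
  have hR : IsChannel (conjBy (wordRot i)) :=
    isChannel_conjBy (by rw [conjTranspose_wordRot, wordRot_mul_self])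
  exact ⟨_, _, hR.comp hE, hD.comp hR, hi⟩

/-- As in the unassisted case. The rotation after the channel is a local unitary of Bob, so the
decoder remains LOCC. -/
lemma IsCppCode.dephasing_of_depolarizing {α ε : ℝ} {n m : ℕ}
    (h : IsCppCode (depolarizing α) n ε m) : IsCppCode (dephasing α) n ε m := by
  obtain ⟨q, E, D, hE, hD, hF⟩ := h
  have hsum : D ∘ₗ ampliate (Fin q) (tensorPow (depolarizing α) n) ∘ₗ E =
      ∑ i : Fin n → Fin 3, (((1 / 3) ^ n : ℝ) : ℂ) •
        ((D ∘ₗ conjBy ((1 : Matrix (Fin q) (Fin q) ℂ) ⊗ₖ wordRot i)) ∘ₗ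
        ampliate (Fin q) (tensorPow (dephasing α) n) ∘ₗ
          (conjBy ((1 : Matrix (Fin q) (Fin q) ℂ) ⊗ₖ wordRot i) ∘ₗ E)) := by
    rw [tensorPow_depolarizing, ampliate_sum]
    refine LinearMap.ext fun X => ?_
    simp [LinearMap.sum_apply, map_sum, ampliate_smul, ampliate_comp, ampliate_conjBy]
  rw [hsum, entFid_sum_smul] at hF
  obtain ⟨i, hi⟩ := exists_le_of_le_sum_uniform hF
  have hU : (wordRot i)ᴴ * wordRot i = 1 := by rw [conjTranspose_wordRot, wordRot_mul_self]
  have hR : IsChannel (conjBy ((1 : Matrix (Fin q) (Fin q) ℂ) ⊗ₖ wordRot i)) :=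
    isChannel_conjBy (by
      rw [Matrix.conjTranspose_kronecker, ← Matrix.mul_kronecker_mul, hU]
      simp)
  exact ⟨q, _, _, hR.comp hE, hD.comp_conjBy hU, hi⟩

/-! ### Converse bounds -/

/-- A test for the error pattern of the dephasing channel: it accepts the errors with probability
at least `1 - ε`. -/
def IsTest (α ε : ℝ) {n : ℕ} (Λ : (Fin n → Fin 2) → ℝ) : Prop :=
  (∀ s, 0 ≤ Λ s ∧ Λ s ≤ 1) ∧ 1 - ε ≤ ∑ s, Λ s * iidPow n (bern α) s

/-- The test is the entanglement fidelity conditioned on the error pattern. By linearity its means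
under the two noise distributions are the fidelities of the two averaged channels. -/
lemma exists_isTest_of_channel {n m : ℕ} (hm : 0 < m) {α ε : ℝ}
    {F : (Fin n → Fin 2) → Matrix (Fin m) (Fin m) ℂ →ₗ[ℂ] Matrix (Fin m) (Fin m) ℂ}
    (hF : ∀ s, IsChannel (F s))
    (h1 : 1 - ε ≤ entFid (∑ s, (iidPow n (bern α) s : ℂ) • F s))
    (h2 : entFid (∑ s, (iidPow n (bern (1 / 2)) s : ℂ) • F s) ≤ 1 / m) :
    ∃ Λ : (Fin n → Fin 2) → ℝ, IsTest α ε Λ ∧ (m : ℝ) * ∑ s, Λ s ≤ 2 ^ n := by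
  refine ⟨fun s => entFid (F s), ⟨fun s => ⟨entFid_nonneg (hF s).1, entFid_le_one hm (hF s)⟩, ?_⟩,
    ?_⟩
  · rw [entFid_sum_smul] at h1
    simpa only [mul_comm] using h1
  · rw [entFid_sum_smul] at h2
    simp only [iidPow_bern_half] at h2
    rw [← Finset.mul_sum, _root_.one_div_pow, one_div_mul_eq_div,
      div_le_div_iff₀ (by positivity) (by exact_mod_cast hm)] at h2
    linarith

lemma isChannel_conjBy_phaseErr {n : ℕ} (s : Fin n → Fin 2) : IsChannel (conjBy (phaseErr s)) :=
  isChannel_conjBy (by rw [conjTranspose_phaseErr, phaseErr_mul_self])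

lemma posSemidef_sandwich {m : ℕ} {b : Type} [Fintype b]
    {E : Matrix (Fin m) (Fin m) ℂ →ₗ[ℂ] Matrix b b ℂ} (hE : IsCompletelyPositive E)
    (v : b → ℂ) : (Matrix.of fun x y =>
      conjBy (Matrix.of fun (_ : Unit) k => v k) (E (Matrix.single x y 1)) () ()).PosSemidef :=
  (posSemidef_choi ((isCompletelyPositive_conjBy (Matrix.of fun (_ : Unit) k => v k)).comp
    hE)).submatrix fun x : Fin m => (x, ())

/-- The functional `X ↦ ⟨v|X|v⟩` (with `v` conjugated). -/
def sandwich {b : Type} [Fintype b] (v : b → ℂ) : Matrix b b ℂ →ₗ[ℂ] ℂ where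
  toFun X := conjBy (Matrix.of fun (_ : Unit) k => v k) X () ()
  map_add' X Y := by rw [map_add]; rfl
  map_smul' t X := by rw [map_smul]; rfl

lemma sandwich_apply {b : Type} [Fintype b] (v : b → ℂ) (X : Matrix b b ℂ) :
    sandwich v X = ∑ i, ∑ j, v i * X i j * star (v j) := by
  simp [sandwich, conjBy_apply_apply]

/-- At noise 1/2 the code measures the channel input in the computational basis and prepares the
decoding of the outcome g, so its fidelity is at most 1/m. -/
lemma IsCode.exists_isTest {α ε : ℝ} {n m : ℕ} (hm : 0 < m) (h : IsCode (dephasing α) n ε m) :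
    ∃ Λ : (Fin n → Fin 2) → ℝ, IsTest α ε Λ ∧ (m : ℝ) * ∑ s, Λ s ≤ 2 ^ n := by
  obtain ⟨E, D, hE, hD, hF⟩ := h
  have hsum : ∀ γ, D ∘ₗ tensorPow (dephasing γ) n ∘ₗ E = ∑ s, (iidPow n (bern γ) s : ℂ) •
      (D ∘ₗ conjBy (phaseErr s) ∘ₗ E) := by
    intro γ
    rw [tensorPow_dephasing]
    refine LinearMap.ext fun X => ?_
    simp [LinearMap.sum_apply, map_sum]
  refine exists_isTest_of_channel hm
    (fun s => hD.comp ((isChannel_conjBy_phaseErr s).comp hE)) (hsum α ▸ hF) ?_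
  rw [← hsum]
  refine entFid_le_of_measurePrepare hm (fun g => sandwich (Pi.single g 1) ∘ₗ E)
    (fun g => D (Matrix.single g g 1)) (fun g => posSemidef_sandwich hE.1 _) (fun g => ?_)
    (fun X => ?_) (fun X => ?_)
  · have h0 : (Matrix.single g g (1 : ℂ)).PosSemidef := by
      have := Matrix.posSemidef_vecMulVec_self_star (Pi.single g (1 : ℂ))
      convert this using 1
      ext i j
      simp [Matrix.single_apply, Matrix.vecMulVec_apply, Pi.single_apply, ← ite_and, eq_comm,
        and_comm]
    -- Positivity of D itself is complete positivity with a one-dimensional reference.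
    have := hD.1 1 ((1 : Matrix (Fin 1) (Fin 1) ℂ) ⊗ₖ Matrix.single g g (1 : ℂ))
      (Matrix.PosSemidef.one.kronecker h0)
    have h2 := this.submatrix fun i : Fin m => ((0 : Fin 1), i)
    convert h2 using 1
    ext i j
    simp only [Matrix.submatrix_apply, ampliate_apply]
    refine congrFun (congrFun (congrArg D ?_) i) j
    ext k l
    simp [Matrix.kroneckerMap_apply]
  · rw [LinearMap.comp_apply, LinearMap.comp_apply]
    have h0 : tensorPow (dephasing (1 / 2)) n (E X) = ∑ g, E X g g • Matrix.single g g (1 : ℂ) := by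
      ext k l
      rw [tensorPow_dephasing_half, Matrix.sum_apply]
      by_cases hkl : k = l
      · subst hkl; simp [Matrix.single_apply]
      · rw [if_neg hkl, Finset.sum_eq_zero]
        intro g _
        simp only [Matrix.smul_apply, Matrix.single_apply, smul_eq_mul, mul_ite, mul_one, mul_zero]
        rw [if_neg]
        rintro ⟨rfl, rfl⟩
        exact hkl rfl
    rw [h0, map_sum]
    refine Finset.sum_congr rfl fun g _ => ?_
    rw [map_smul, LinearMap.comp_apply, sandwich_apply]
    simp [Pi.single_apply]
  · rw [LinearMap.comp_apply, LinearMap.comp_apply, hD.2, ← hE.2 X]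
    simp only [Matrix.trace, Matrix.diag_apply, tensorPow_dephasing_half,
      if_true]

/-- Although Q keeps its coherence, a product Kraus operator only evaluates a functional on it. With
Bⁿ measured, the pair of Kraus label r and outcome g is therefore a classical record, from which
Bob's column g of `B r` is prepared. -/
lemma IsCppCode.exists_isTest {α ε : ℝ} {n m : ℕ} (hm : 0 < m)
    (h : IsCppCode (dephasing α) n ε m) :
    ∃ Λ : (Fin n → Fin 2) → ℝ, IsTest α ε Λ ∧ (m : ℝ) * ∑ s, Λ s ≤ 2 ^ n := by
  obtain ⟨q, E, D, hE, hD, hF⟩ := h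
  have hsum : ∀ γ, D ∘ₗ ampliate (Fin q) (tensorPow (dephasing γ) n) ∘ₗ E =
      ∑ s, (iidPow n (bern γ) s : ℂ) •
        (D ∘ₗ conjBy ((1 : Matrix (Fin q) (Fin q) ℂ) ⊗ₖ phaseErr s) ∘ₗ E) := by
    intro γ
    rw [tensorPow_dephasing, ampliate_sum]
    refine LinearMap.ext fun X => ?_
    simp [LinearMap.sum_apply, map_sum, ampliate_smul, ampliate_conjBy]
  have hZ : ∀ s : Fin n → Fin 2,
      IsChannel (conjBy ((1 : Matrix (Fin q) (Fin q) ℂ) ⊗ₖ phaseErr s)) := fun s =>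
    isChannel_conjBy (by
      rw [Matrix.conjTranspose_kronecker, ← Matrix.mul_kronecker_mul, conjTranspose_phaseErr,
        phaseErr_mul_self]
      simp)
  refine exists_isTest_of_channel hm
    (fun s => hD.isChannel.comp ((hZ s).comp hE)) (hsum α ▸ hF) ?_
  rw [← hsum]
  obtain ⟨htr, κ, _, A, B, hAB⟩ := hD.exists_kraus
  refine entFid_le_of_measurePrepare hm
    (fun r : κ × (Fin n → Fin 2) => sandwich (fun x => if x.2 = r.2 then A r.1 x.1 else 0) ∘ₗ E)
    (fun r => Matrix.vecMulVec (fun j => B r.1 j r.2) (star fun j => B r.1 j r.2))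
    (fun r => posSemidef_sandwich hE.1 _) (fun r => Matrix.posSemidef_vecMulVec_self_star _)
    (fun X => ?_) (fun X => ?_)
  · rw [LinearMap.comp_apply, LinearMap.comp_apply, hAB, LinearMap.sum_apply,
      Fintype.sum_prod_type]
    refine Finset.sum_congr rfl fun r _ => ?_
    ext j l
    simp only [conjBy_apply_apply, ampliate_apply, tensorPow_dephasing_half, Matrix.of_apply,
      Fintype.sum_prod_type, Matrix.sum_apply, Matrix.smul_apply, smul_eq_mul,
      LinearMap.comp_apply, sandwich_apply, Matrix.vecMulVec_apply, Pi.star_apply, ite_mul,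
      zero_mul, mul_ite, mul_zero, apply_ite star, star_zero, Finset.sum_ite_eq, Finset.sum_ite_eq',
      Finset.mem_univ, if_true, star_mul']
    rw [Finset.sum_comm]
    refine Finset.sum_congr rfl fun g _ => ?_
    rw [Finset.sum_mul]
    refine Finset.sum_congr rfl fun x _ => ?_
    rw [Finset.sum_eq_single g (fun g' _ hg => by simp [hg]) (by simp), Finset.sum_mul]
    refine Finset.sum_congr rfl fun y _ => ?_
    rw [if_pos rfl]
    ring
  · rw [LinearMap.comp_apply, LinearMap.comp_apply, htr, ← hE.2 X]
    simp only [Matrix.trace, Matrix.diag_apply, ampliate_apply,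
      tensorPow_dephasing_half, if_true, Matrix.of_apply]

/-! ### Codes for the dephasing channel from cosets -/

/-- `T` contains exactly one element of each coset of `C`. -/
def IsTransversal {G : Type} [AddCommGroup G] (C : AddSubgroup G) (T : Finset G) : Prop :=
  ∀ g, ∃! t, t ∈ T ∧ g - t ∈ C

/-- The operator that adds an error pattern to the basis states. -/
def flipErr {n : ℕ} (s : Fin n → Fin 2) : Matrix (Fin n → Fin 2) (Fin n → Fin 2) ℂ :=
  Matrix.of fun k i => if k = i + s then 1 else 0

/-- The Hadamard transformation of `n` qubits. -/
def hadamardAll (n : ℕ) : Matrix (Fin n → Fin 2) (Fin n → Fin 2) ℂ := wordRot fun _ => 1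

lemma hadamardAll_mul_phaseErr {n : ℕ} (s : Fin n → Fin 2) :
    hadamardAll n * phaseErr s * hadamardAll n = flipErr s := by
  rw [hadamardAll, wordRot, phaseErr, tens_mul, tens_mul]
  have h : ∀ (s k i : Fin 2), (axisRot 1 * phaseOp s * axisRot 1) k i =
      if k = i + s then 1 else 0 := by
    intro s k i
    have hs : axisRot 1 * phaseOp s * axisRot 1 = if s = 0 then 1 else pauliX := by
      unfold phaseOp
      split_ifs
      · rw [Matrix.mul_one, axisRot_mul_self]
      · exact axisRot_mul_pauliZ_mul 1
    rw [hs]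
    fin_cases s <;> fin_cases k <;> fin_cases i <;> simp [pauliX]
  ext k i
  simp only [tens, flipErr, Matrix.of_apply, h, Finset.prod_ite_zero, Finset.prod_const_one,
    funext_iff, Finset.mem_univ, true_implies, Pi.add_apply]

lemma conjTranspose_hadamardAll (n : ℕ) : (hadamardAll n)ᴴ = hadamardAll n :=
  conjTranspose_wordRot _

lemma hadamardAll_mul_self (n : ℕ) : hadamardAll n * hadamardAll n = 1 := wordRot_mul_self _

lemma conjTranspose_flipErr {n : ℕ} (s : Fin n → Fin 2) : (flipErr s)ᴴ = flipErr s := by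
  rw [← hadamardAll_mul_phaseErr, Matrix.conjTranspose_mul, Matrix.conjTranspose_mul,
    conjTranspose_hadamardAll, conjTranspose_phaseErr, Matrix.mul_assoc]

lemma flipErr_mul_self {n : ℕ} (s : Fin n → Fin 2) : flipErr s * flipErr s = 1 := by
  rw [← hadamardAll_mul_phaseErr]
  calc _ = hadamardAll n * phaseErr s * (hadamardAll n * hadamardAll n) * phaseErr s *
        hadamardAll n := by simp only [Matrix.mul_assoc]
    _ = hadamardAll n * (phaseErr s * phaseErr s) * hadamardAll n := by
        rw [hadamardAll_mul_self, Matrix.mul_one, Matrix.mul_assoc (hadamardAll n)]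
    _ = 1 := by rw [phaseErr_mul_self, Matrix.mul_one, hadamardAll_mul_self]

/-- A subgroup `C` of the bit strings gives a code of size `|C|` for the dephasing channel that
corrects every error in a given transversal of `C`. -/
lemma isCode_of_isTransversal {n : ℕ} {C : AddSubgroup (Fin n → Fin 2)}
    {T : Finset (Fin n → Fin 2)} (hT : IsTransversal C T) {α ε : ℝ} (hα : α ∈ Set.Icc (0 : ℝ) 1)
    (h : 1 - ε ≤ ∑ t ∈ T, iidPow n (bern α) t) : IsCode (dephasing α) n ε (Nat.card C) := by
  classical
  set m := Nat.card C with hm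
  have hm0 : 0 < m := Nat.card_pos
  let e : Fin m ≃ C := (Finite.equivFin C).symm
  let V : Matrix (Fin n → Fin 2) (Fin m) ℂ := Matrix.of fun g j => if g = e j then 1 else 0
  have hV : Vᴴ * V = 1 := by
    ext i j
    simp [V, Matrix.mul_apply, Matrix.one_apply, eq_comm]
  have hVV : ∀ t : Fin n → Fin 2, flipErr t * V = Matrix.of fun g j =>
      if g = e j + t then (1 : ℂ) else 0 := by
    intro t
    ext g j
    simp [V, flipErr, Matrix.mul_apply]
  -- The translates of C by T partition the bit strings, so the projections onto their spans resolve
  -- the identity. This makes the decoder trace preserving.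
  have hsum : ∑ t ∈ T, (flipErr t * V) * (flipErr t * V)ᴴ = 1 := by
    ext g g'
    rw [Matrix.sum_apply]
    have h1 : ∀ t, ((flipErr t * V) * (flipErr t * V)ᴴ) g g' =
        if g = g' then (if g - t ∈ C then 1 else 0) else 0 := by
      intro t
      rw [hVV]
      simp only [Matrix.mul_apply, Matrix.conjTranspose_apply, Matrix.of_apply, apply_ite star,
        star_one, star_zero, ite_mul, one_mul, zero_mul]
      split_ifs with hg hC
      · rw [Finset.sum_eq_single (e.symm ⟨g - t, hC⟩)]
        · simp [← hg]
        · intro j _ hj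
          rw [if_neg]
          rintro h2
          apply hj
          rw [Equiv.eq_symm_apply, Subtype.ext_iff]
          simp [h2]
        · simp
      · refine Finset.sum_eq_zero fun j _ => ?_
        rw [if_neg]
        rintro h2
        exact hC (by rw [h2, add_sub_cancel_right]; exact (e j).2)
      · refine Finset.sum_eq_zero fun j _ => ?_
        split_ifs with h2 h3
        · exact absurd (h2.trans h3.symm) hg
        · rfl
        · rfl
    simp only [h1]
    by_cases hg : g = g'
    · obtain ⟨t, ⟨htT, htC⟩, hu⟩ := hT g
      simp only [hg, if_true, Matrix.one_apply]
      rw [← hg, Finset.sum_eq_single t]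
      · rw [if_pos htC]
      · intro t' ht' hne
        rw [if_neg fun hc => hne (hu t' ⟨ht', hc⟩)]
      · exact fun hc => absurd htT hc
    · simp [hg]
  set H := hadamardAll n
  have hH : Hᴴ = H := conjTranspose_hadamardAll n
  have hHH : H * H = 1 := hadamardAll_mul_self n
  -- The decoder undoes the Hadamard transformation, finds the translate C + t, and subtracts t.
  let Dk : (Fin n → Fin 2) → Matrix (Fin m) (Fin n → Fin 2) ℂ := fun t => (flipErr t * V)ᴴ * H
  have hE : IsChannel (conjBy (H * V)) := isChannel_conjBy (by
    rw [Matrix.conjTranspose_mul, hH, Matrix.mul_assoc, ← Matrix.mul_assoc H, hHH, Matrix.one_mul,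
      hV])
  have hD : IsChannel (∑ t ∈ T, conjBy (Dk t)) := isChannel_sum_conjBy T Dk (by
    have : ∀ t, (Dk t)ᴴ * Dk t = H * ((flipErr t * V) * (flipErr t * V)ᴴ) * H := by
      intro t
      simp only [Dk]
      rw [Matrix.conjTranspose_mul, hH, Matrix.conjTranspose_conjTranspose]
      simp only [Matrix.mul_assoc]
    simp only [this]
    rw [← Finset.sum_mul, ← Finset.mul_sum, hsum, Matrix.mul_one, hHH])
  refine ⟨_, _, hE, hD, h.trans ?_⟩
  have hdec : (∑ t ∈ T, conjBy (Dk t)) ∘ₗ tensorPow (dephasing α) n ∘ₗ conjBy (H * V) =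
      ∑ s, (iidPow n (bern α) s : ℂ) • ∑ t ∈ T, conjBy (Dk t * (phaseErr s * (H * V))) := by
    rw [tensorPow_dephasing]
    refine LinearMap.ext fun X => ?_
    simp only [← conjBy_comp, LinearMap.sum_apply, LinearMap.comp_apply, LinearMap.smul_apply,
      map_sum, map_smul, Finset.smul_sum]
  rw [hdec, entFid_sum_smul]
  -- If the error s lies in T, the Kraus operator with t = s restores the input exactly, and the
  -- others contribute nonnegative fidelity.
  have hterm : ∀ s ∈ T, 1 ≤ entFid (∑ t ∈ T, conjBy (Dk t * (phaseErr s * (H * V)))) := by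
    intro s hs
    have h1 : Dk s * (phaseErr s * (H * V)) = 1 := by
      simp only [Dk]
      rw [Matrix.conjTranspose_mul, conjTranspose_flipErr]
      calc _ = Vᴴ * (flipErr s * (H * phaseErr s * H)) * V := by simp only [Matrix.mul_assoc]
        _ = 1 := by
          rw [hadamardAll_mul_phaseErr, flipErr_mul_self, Matrix.mul_one, hV]
    rw [entFid_sum]
    refine le_trans ?_ (Finset.single_le_sum (f := fun t =>
      entFid (conjBy (Dk t * (phaseErr s * (H * V)))))
      (fun t _ => entFid_nonneg (isCompletelyPositive_conjBy _)) hs)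
    simp only [h1]
    rw [entFid_conjBy, Matrix.trace_one, Fintype.card_fin]
    have : (m : ℝ) ≠ 0 := by exact_mod_cast hm0.ne'
    simp [Complex.normSq_natCast, sq, this]
  calc ∑ t ∈ T, iidPow n (bern α) t
      ≤ ∑ s ∈ T, iidPow n (bern α) s *
          entFid (∑ t ∈ T, conjBy (Dk t * (phaseErr s * (H * V)))) :=
        Finset.sum_le_sum fun s hs =>
          le_mul_of_one_le_right (iidPow_nonneg (bern_nonneg hα) s) (hterm s hs)
    _ ≤ _ := Finset.sum_le_sum_of_subset_of_nonneg (Finset.subset_univ T) fun s _ _ =>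
        mul_nonneg (iidPow_nonneg (bern_nonneg hα) s) (entFid_nonneg
          (isCompletelyPositive_sum _ fun t _ => isCompletelyPositive_conjBy _))

/-! ### Random linear codes -/

/-- Minimum-weight decoding: an N-minimal element is chosen in each coset. An element left out is
matched or beaten by the representative of its own coset. -/
lemma exists_isTransversal_min {G : Type} [AddCommGroup G] [Finite G] (C : AddSubgroup G)
    (N : G → ℕ) : ∃ T : Finset G, IsTransversal C T ∧
      ∀ e, e ∉ T → ∃ e', e' ≠ e ∧ N e' ≤ N e ∧ e - e' ∈ C := by
  classical
  have h : ∀ q : G ⧸ C, ∃ t : G, (t : G ⧸ C) = q ∧ ∀ g : G, (g : G ⧸ C) = q → N t ≤ N g := by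
    intro q
    obtain ⟨g₀, rfl⟩ := QuotientAddGroup.mk_surjective q
    obtain ⟨t, ht, hmin⟩ := Set.exists_min_image {g : G | (g : G ⧸ C) = g₀} N (Set.toFinite _)
      ⟨g₀, rfl⟩
    exact ⟨t, ht, hmin⟩
  choose t ht hmin using h
  have hfin : Fintype (G ⧸ C) := Fintype.ofFinite _
  have hsub : ∀ g : G, g - t g ∈ C := fun g => by
    have := QuotientAddGroup.eq.mp (ht (g : G ⧸ C))
    rwa [neg_add_eq_sub] at this
  have hmk : ∀ {g g' : G}, g - g' ∈ C → (g' : G ⧸ C) = g := fun h => by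
    rw [QuotientAddGroup.eq, neg_add_eq_sub]; exact h
  refine ⟨Finset.univ.image t, fun g => ⟨t g, ⟨Finset.mem_image_of_mem _ (Finset.mem_univ _),
    hsub g⟩, ?_⟩, fun e he => ⟨t e, ?_, hmin _ _ rfl, hsub e⟩⟩
  · rintro t' ⟨ht', hC⟩
    obtain ⟨q, -, rfl⟩ := Finset.mem_image.mp ht'
    rw [← hmk hC, ht]
  · intro hc
    exact he (hc ▸ Finset.mem_image_of_mem _ (Finset.mem_univ _))

/-- A family of subgroups of size `2 ^ k` that covers the nonzero bit strings uniformly. -/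
lemma exists_uniform_family {n k : ℕ} (hn : 0 < n) (hk : k ≤ n) :
    ∃ (A : Type) (_ : Fintype A) (_ : Nonempty A) (C : A → AddSubgroup (Fin n → Fin 2)),
      (∀ a, Nat.card (C a) = 2 ^ k) ∧ ∀ x, x ≠ 0 →
        (Nat.card {a // x ∈ C a} : ℝ) ≤ 2 ^ k / 2 ^ n * Fintype.card A := by
  classical
  let F := GaloisField 2 n
  have hFin : Finite F := inferInstanceAs (Finite (GaloisField 2 n))
  have hF : Fintype F := Fintype.ofFinite F
  have hcard : Nat.card F = 2 ^ n := GaloisField.card 2 n hn.ne'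
  -- `Fin 2` and `ZMod 2` agree definitionally, so this linear isomorphism also serves for bit
  -- strings over `Fin 2`.
  let φ₀ : (Fin n → ZMod 2) ≃ₗ[ZMod 2] F := LinearEquiv.ofFinrankEq _ _ (by
    rw [Module.finrank_fin_fun, GaloisField.finrank 2 hn.ne'])
  let φ : (Fin n → Fin 2) ≃+ F := φ₀.toAddEquiv
  obtain ⟨C₀, hC₀⟩ : ∃ C₀ : AddSubgroup F, Nat.card C₀ = 2 ^ k := by
    obtain ⟨K, hK⟩ := Sylow.exists_subgroup_card_pow_prime (G := Multiplicative F) 2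
      (n := k) (by
        rw [show Nat.card (Multiplicative F) = 2 ^ n from hcard]
        exact pow_dvd_pow 2 hk)
    exact ⟨Subgroup.toAddSubgroup' K, hK⟩
  let ψ : Fˣ → (Fin n → Fin 2) ≃+ F := fun a => φ.trans (DistribMulAction.toAddEquiv F a)
  refine ⟨Fˣ, inferInstance, inferInstance, fun a => C₀.comap (ψ a).toAddMonoidHom,
    fun a => ?_, fun x hx => ?_⟩
  · rw [← hC₀]
    exact Nat.card_congr ((ψ a).toEquiv.subtypeEquiv fun g => Iff.rfl)
  · have hx' : φ x ≠ 0 := by simpa using hx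
    -- For x ≠ 0 the products a φ(x) are distinct and nonzero, so at most 2^k - 1 of the 2^n - 1
    -- units put x in the subgroup. This fraction is at most 2^k / 2^n because k ≤ n.
    have h1 : Nat.card {a : Fˣ // x ∈ C₀.comap (ψ a).toAddMonoidHom} ≤ 2 ^ k - 1 := by
      have hinj : Function.Injective (fun a : {a : Fˣ // x ∈ C₀.comap (ψ a).toAddMonoidHom} =>
          (⟨⟨(a.1 : F) * φ x, a.2⟩, fun h => (mul_ne_zero a.1.ne_zero hx')
            (congrArg Subtype.val h)⟩ : {c : C₀ // c ≠ 0})) := by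
        intro a b hab
        have h2 : (a.1 : F) * φ x = b.1 * φ x :=
          congrArg (fun c => ((c.1 : C₀) : F)) hab
        exact Subtype.ext (Units.ext (mul_right_cancel₀ hx' h2))
      have h3 := Nat.card_le_card_of_injective _ hinj
      have h4 : Nat.card {c : C₀ // c ≠ 0} = 2 ^ k - 1 := by
        have : Fintype C₀ := Fintype.ofFinite _
        rw [Nat.card_eq_fintype_card, Fintype.card_subtype_compl, ← Nat.card_eq_fintype_card, hC₀]
        simp
      rwa [h4] at h3
    have h5 : Fintype.card Fˣ = 2 ^ n - 1 := by
      rw [Fintype.card_units, ← Nat.card_eq_fintype_card, hcard]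
    rw [h5, Nat.cast_sub Nat.one_le_two_pow, div_mul_eq_mul_div, le_div_iff₀ (by positivity)]
    have h6 : (Nat.card {a : Fˣ // x ∈ C₀.comap (ψ a).toAddMonoidHom} : ℝ) ≤ 2 ^ k - 1 := by
      have := (Nat.cast_le (α := ℝ)).mpr h1
      rw [Nat.cast_sub Nat.one_le_two_pow] at this
      simpa using this
    have h7 : (2 : ℝ) ^ k ≤ 2 ^ n := pow_le_pow_right₀ (by norm_num) hk
    push_cast
    nlinarith [pow_pos (show (0 : ℝ) < 2 by norm_num) n]

/-- The random coding union bound for linear codes. -/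
lemma exists_code_error_le {n k : ℕ} (hn : 0 < n) (hk : k ≤ n) {P : (Fin n → Fin 2) → ℝ}
    (hP : ∀ e, 0 ≤ P e) (N : (Fin n → Fin 2) → ℕ) :
    ∃ (C : AddSubgroup (Fin n → Fin 2)) (T : Finset (Fin n → Fin 2)), Nat.card C = 2 ^ k ∧
      IsTransversal C T ∧ ∑ e ∈ Tᶜ, P e ≤
        ∑ e, P e * min (1 : ℝ) (2 ^ k / 2 ^ n * (Finset.univ.filter fun e' => N e' ≤ N e).card) := by
  classical
  obtain ⟨A, _, _, C, hC, hcov⟩ := exists_uniform_family hn hk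
  choose T hT hmin using fun a => exists_isTransversal_min (C a) N
  -- An error e fails for `C a` only if some other e' of no larger weight lies in its coset. The
  -- union bound over e' uses the uniform covering of the nonzero word e - e', and the trivial bound
  -- 1 is kept as the alternative.
  have key : ∀ e, ∑ a, (if e ∈ T a then (0 : ℝ) else 1) ≤ Fintype.card A *
      min (1 : ℝ) (2 ^ k / 2 ^ n * (Finset.univ.filter fun e' => N e' ≤ N e).card) := by
    intro e
    have h1 : ∑ a, (if e ∈ T a then (0 : ℝ) else 1) ≤ Fintype.card A := by
      calc _ ≤ ∑ a : A, (1 : ℝ) := Finset.sum_le_sum fun a _ => by split_ifs <;> norm_num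
        _ = _ := by simp
    have h2 : ∑ a, (if e ∈ T a then (0 : ℝ) else 1) ≤
        ∑ a, ∑ e' ∈ Finset.univ.filter fun e' => N e' ≤ N e,
          (if e' ≠ e ∧ e - e' ∈ C a then (1 : ℝ) else 0) := by
      refine Finset.sum_le_sum fun a _ => ?_
      have h0 : ∀ e' ∈ Finset.univ.filter fun e' => N e' ≤ N e,
          0 ≤ (if e' ≠ e ∧ e - e' ∈ C a then (1 : ℝ) else 0) := fun e' _ => by
        split_ifs <;> norm_num
      split_ifs with he
      · exact Finset.sum_nonneg h0
      · obtain ⟨e', h3, h4, h5⟩ := hmin a e he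
        refine le_trans ?_ (Finset.single_le_sum h0
          (Finset.mem_filter.mpr ⟨Finset.mem_univ e', h4⟩))
        rw [if_pos ⟨h3, h5⟩]
    have h3 : ∑ a, ∑ e' ∈ Finset.univ.filter fun e' => N e' ≤ N e,
          (if e' ≠ e ∧ e - e' ∈ C a then (1 : ℝ) else 0) ≤
        ∑ e' ∈ Finset.univ.filter fun e' => N e' ≤ N e, 2 ^ k / 2 ^ n * (Fintype.card A : ℝ) := by
      rw [Finset.sum_comm]
      refine Finset.sum_le_sum fun e' _ => ?_
      by_cases he : e' = e
      · simp only [he, ne_eq, not_true_eq_false, false_and, if_false, Finset.sum_const_zero]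
        positivity
      · refine le_trans (le_of_eq ?_) (hcov (e - e') (sub_ne_zero.mpr (Ne.symm he)))
        simp [he, Nat.card_eq_fintype_card, Fintype.card_subtype]
    rw [Finset.sum_const, nsmul_eq_mul] at h3
    rcases le_total 1 ((2 : ℝ) ^ k / 2 ^ n *
      (Finset.univ.filter fun e' => N e' ≤ N e).card) with h | h
    · rw [min_eq_left h, mul_one]; exact h1
    · rw [min_eq_right h]; exact (h2.trans h3).trans (le_of_eq (by ring))
  have hsum : ∑ a, ∑ e ∈ (T a)ᶜ, P e ≤ ∑ _a : A,
      ∑ e, P e * min (1 : ℝ) (2 ^ k / 2 ^ n * (Finset.univ.filter fun e' => N e' ≤ N e).card) := by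
    calc ∑ a, ∑ e ∈ (T a)ᶜ, P e = ∑ a, ∑ e, P e * (if e ∈ T a then (0 : ℝ) else 1) := by
          refine Finset.sum_congr rfl fun a _ => ?_
          rw [← Finset.sum_add_sum_compl (T a)]
          have h0 : ∑ e ∈ T a, P e * (if e ∈ T a then (0 : ℝ) else 1) = 0 :=
            Finset.sum_eq_zero fun e he => by rw [if_pos he, mul_zero]
          rw [h0, zero_add]
          exact Finset.sum_congr rfl fun e he => by
            rw [if_neg (Finset.mem_compl.mp he), mul_one]
      _ = ∑ e, P e * ∑ a, (if e ∈ T a then (0 : ℝ) else 1) := by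
          rw [Finset.sum_comm]
          simp only [Finset.mul_sum]
      _ ≤ ∑ e, P e * (Fintype.card A *
          min (1 : ℝ) (2 ^ k / 2 ^ n * (Finset.univ.filter fun e' => N e' ≤ N e).card)) :=
          Finset.sum_le_sum fun e _ => mul_le_mul_of_nonneg_left (key e) (hP e)
      _ = _ := by
          rw [Finset.sum_const, Finset.card_univ, nsmul_eq_mul, Finset.mul_sum]
          exact Finset.sum_congr rfl fun e _ => by ring
  -- Some member of the family does at least as well as the average.
  obtain ⟨a, -, ha⟩ := Finset.exists_le_of_sum_le Finset.univ_nonempty hsum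
  exact ⟨C a, T a, hC a, hT a, ha⟩

/-! ### Binomial estimates -/

/-- The probability of a given word of weight `w`. -/
def wordProb (α : ℝ) (n w : ℕ) : ℝ := α ^ w * (1 - α) ^ (n - w)

/-- The binomial probabilities. -/
def binProb (α : ℝ) (n w : ℕ) : ℝ := n.choose w * wordProb α n w

/-- The size of the Hamming ball of radius `w`. -/
def ballSize (n w : ℕ) : ℝ := ∑ j ∈ Finset.range (w + 1), (n.choose j : ℝ)

/-- The binomial distribution function. -/
def binCdf (α : ℝ) (n w : ℕ) : ℝ := ∑ j ∈ Finset.range (w + 1), binProb α n j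

lemma iidPow_bern (α : ℝ) {n : ℕ} (e : Fin n → Fin 2) :
    iidPow n (bern α) e = wordProb α n (hammingNorm e) := by
  have h1 := Finset.card_filter_add_card_filter_not (s := (Finset.univ : Finset (Fin n)))
    (fun i => e i = 0)
  rw [Finset.card_univ, Fintype.card_fin] at h1
  have h2 : n - hammingNorm e = (Finset.univ.filter fun i => e i = 0).card := by
    simp only [hammingNorm, ne_eq]
    omega
  rw [wordProb, h2, hammingNorm, iidPow]
  simp only [bern]
  rw [Finset.prod_ite, Finset.prod_const, Finset.prod_const, mul_comm]

lemma sum_hammingNorm {n : ℕ} (f : ℕ → ℝ) :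
    ∑ e : Fin n → Fin 2, f (hammingNorm e) = ∑ w ∈ Finset.range (n + 1), n.choose w * f w := by
  have h := Finset.sum_powerset_apply_card f (x := (Finset.univ : Finset (Fin n)))
  rw [Finset.card_univ, Fintype.card_fin] at h
  simp only [nsmul_eq_mul] at h
  rw [← h]
  refine Finset.sum_bij' (fun e _ => Finset.univ.filter fun i => e i ≠ 0)
    (fun s _ => fun i => if i ∈ s then 1 else 0) (fun _ _ => by simp) (fun _ _ => by simp)
    (fun e _ => ?_) (fun s _ => ?_) (fun e _ => rfl)
  · funext i
    by_cases hi : e i = 0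
    · simp [hi]
    · have : e i = 1 := Fin.eq_one_of_ne_zero _ hi
      simp [this]
  · ext i
    simp

lemma sum_range_ite_le {n u : ℕ} (hu : u ≤ n) (g : ℕ → ℝ) :
    ∑ w ∈ Finset.range (n + 1), (if w ≤ u then g w else 0) = ∑ w ∈ Finset.range (u + 1), g w := by
  rw [← Finset.sum_filter]
  congr 1
  ext w
  simp only [Finset.mem_filter, Finset.mem_range]
  omega

lemma sum_hammingNorm_ite {n u : ℕ} (hu : u ≤ n) (g : ℕ → ℝ) :
    ∑ e : Fin n → Fin 2, (if hammingNorm e ≤ u then g (hammingNorm e) else 0) =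
      ∑ w ∈ Finset.range (u + 1), n.choose w * g w := by
  rw [sum_hammingNorm fun w => if w ≤ u then g w else 0, ← sum_range_ite_le hu]
  simp

lemma card_hammingBall {n u : ℕ} (hu : u ≤ n) :
    ((Finset.univ.filter fun e : Fin n → Fin 2 => hammingNorm e ≤ u).card : ℝ) = ballSize n u := by
  have h := sum_hammingNorm_ite hu fun _ => 1
  simpa [ballSize] using h

lemma hammingNorm_le {n : ℕ} (e : Fin n → Fin 2) : hammingNorm e ≤ n := by
  simpa using hammingNorm_le_card_fintype (x := e)

lemma wordProb_nonneg {α : ℝ} (hα : α ∈ Set.Icc (0 : ℝ) 1) (n w : ℕ) : 0 ≤ wordProb α n w :=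
  mul_nonneg (pow_nonneg hα.1 _) (pow_nonneg (by linarith [hα.2]) _)

lemma binProb_nonneg {α : ℝ} (hα : α ∈ Set.Icc (0 : ℝ) 1) (n w : ℕ) : 0 ≤ binProb α n w :=
  mul_nonneg (Nat.cast_nonneg _) (wordProb_nonneg hα n w)

lemma wordProb_succ {α : ℝ} (hα0 : 0 < α) {n w : ℕ} (hw : w < n) :
    wordProb α n w = (1 - α) / α * wordProb α n (w + 1) := by
  obtain ⟨d, rfl⟩ := Nat.exists_eq_add_of_lt hw
  have h1 : w + d + 1 - w = d + 1 := by omega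
  have h2 : w + d + 1 - (w + 1) = d := by omega
  rw [wordProb, wordProb, h1, h2]
  field_simp
  ring

lemma wordProb_antitone {α : ℝ} (hα0 : 0 < α) (hα2 : α < 1 / 2) {n w w' : ℕ} (h : w ≤ w')
    (hw' : w' ≤ n) : wordProb α n w' ≤ wordProb α n w := by
  induction w', h using Nat.le_induction with
  | base => exact le_rfl
  | succ w' h ih =>
    refine le_trans ?_ (ih (by omega))
    rw [wordProb_succ hα0 (show w' < n by omega)]
    refine le_mul_of_one_le_left (wordProb_nonneg ⟨hα0.le, by linarith⟩ _ _) ?_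
    rw [le_div_iff₀ hα0]
    linarith

lemma binCdf_self (α : ℝ) (n : ℕ) : binCdf α n n = 1 := by
  have h := sum_hammingNorm (n := n) (wordProb α n)
  simp only [← iidPow_bern, sum_iidPow_bern] at h
  exact h.symm

lemma binProb_eq_eval (α : ℝ) (n w : ℕ) :
    binProb α n w = (bernsteinPolynomial ℝ n w).eval α := by
  simp [binProb, wordProb, bernsteinPolynomial, mul_assoc]

/-- Chebyshev's inequality for the binomial distribution. -/
lemma sum_binProb_le_of_far {α : ℝ} (hα : α ∈ Set.Icc (0 : ℝ) 1) {n : ℕ} (hn : 0 < n) {η : ℝ}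
    (hη : 0 < η) {s : Finset ℕ} (hs : s ⊆ Finset.range (n + 1))
    (hfar : ∀ w ∈ s, n * η ≤ |n * α - w|) :
    ∑ w ∈ s, binProb α n w ≤ 1 / (n * η ^ 2) := by
  have hn' : (0 : ℝ) < n := by exact_mod_cast hn
  have hvar : ∑ w ∈ Finset.range (n + 1), (n * α - w) ^ 2 * binProb α n w =
      n * α * (1 - α) := by
    have := congrArg (Polynomial.eval α) (bernsteinPolynomial.variance ℝ n)
    simpa [Polynomial.eval_finsetSum, ← binProb_eq_eval] using this
  have h1 : (n * η) ^ 2 * ∑ w ∈ s, binProb α n w ≤ n * α * (1 - α) := by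
    rw [← hvar, Finset.mul_sum]
    calc _ ≤ ∑ w ∈ s, (n * α - w) ^ 2 * binProb α n w := by
          refine Finset.sum_le_sum fun w hw => ?_
          refine mul_le_mul_of_nonneg_right ?_ (binProb_nonneg hα n w)
          rw [← sq_abs (n * α - (w : ℝ))]
          exact pow_le_pow_left₀ (by positivity) (hfar w hw) 2
      _ ≤ _ := Finset.sum_le_sum_of_subset_of_nonneg hs fun w _ _ =>
          mul_nonneg (sq_nonneg _) (binProb_nonneg hα n w)
  have h2 : α * (1 - α) ≤ 1 := by nlinarith [hα.1, hα.2]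
  have h3 : (n : ℝ) * (n * η ^ 2 * ∑ w ∈ s, binProb α n w) ≤ n * 1 := by nlinarith
  rw [le_div_iff₀ (by positivity)]
  have := le_of_mul_le_mul_left h3 hn'
  linarith

/-- Under geometric growth a sum is controlled by its last term. With 1 - r on the left, no bound r
< 1 is needed here. -/
lemma geom_sum_le {a : ℕ → ℝ} {r : ℝ} (hr : 0 ≤ r) (ha : 0 ≤ a 0) {v : ℕ}
    (h : ∀ w < v, a w ≤ r * a (w + 1)) {w : ℕ} (hw : w ≤ v) :
    (1 - r) * ∑ j ∈ Finset.range (w + 1), a j ≤ a w := by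
  induction w with
  | zero => simp; nlinarith
  | succ w ih =>
    rw [Finset.sum_range_succ, mul_add]
    have := ih (by omega)
    have := h w (by omega)
    linarith

section Growth

variable {n v : ℕ} {q : ℝ}

/-- Consecutive binomial coefficients have ratio (w + 1) / (n - w), and q is a uniform bound for
these odds below the radius v. -/
lemma choose_le_of_odds (hv : v ≤ n) (hq : ∀ w < v, (w + 1 : ℝ) ≤ q * (n - w)) {w : ℕ}
    (hw : w < v) : (n.choose w : ℝ) ≤ q * n.choose (w + 1) := by
  have h1 : (n.choose (w + 1) : ℝ) * (w + 1) = n.choose w * (n - w) := by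
    have := Nat.choose_succ_right_eq n w
    rw [← Nat.cast_inj (R := ℝ)] at this
    push_cast [Nat.cast_sub (show w ≤ n by omega)] at this
    exact this
  have h2 : (0 : ℝ) < n - w := by
    rw [sub_pos]; exact_mod_cast (by omega : w < n)
  have h3 : (n.choose (w + 1) : ℝ) * (w + 1) ≤ n.choose (w + 1) * (q * (n - w)) :=
    mul_le_mul_of_nonneg_left (hq w hw) (Nat.cast_nonneg _)
  have h4 : (n.choose w : ℝ) * (n - w) ≤ (q * n.choose (w + 1)) * (n - w) := by linarith
  exact le_of_mul_le_mul_right h4 h2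

lemma ballSize_le_choose (hv : v ≤ n) (hq0 : 0 ≤ q)
    (hq : ∀ w < v, (w + 1 : ℝ) ≤ q * (n - w)) : (1 - q) * ballSize n v ≤ n.choose v :=
  geom_sum_le (a := fun j => (n.choose j : ℝ)) hq0 (by simp)
    (fun _ hw => choose_le_of_odds hv hq hw) le_rfl

lemma ballSize_le_of_odds (hv : v ≤ n) (hq0 : 0 ≤ q)
    (hq : ∀ w < v, (w + 1 : ℝ) ≤ q * (n - w)) {w : ℕ} (hw : w < v) :
    ballSize n w ≤ q * ballSize n (w + 1) := by
  rw [ballSize, ballSize, Finset.sum_range_succ' _ (w + 1), mul_add, Finset.mul_sum]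
  have h1 : ∑ j ∈ Finset.range (w + 1), (n.choose j : ℝ) ≤
      ∑ j ∈ Finset.range (w + 1), q * (n.choose (j + 1) : ℝ) :=
    Finset.sum_le_sum fun j hj => choose_le_of_odds hv hq (by
      have := Finset.mem_range.mp hj; omega)
  have h2 : 0 ≤ q * (n.choose 0 : ℝ) := by positivity
  linarith

/-- Each step down from w + 1 to w costs a factor q in the binomial coefficient, another q in the
ball, and gains (1 - α) / α in the word probability. -/
lemma sum_binProb_mul_ballSize_le {α : ℝ} (hα0 : 0 < α) (hα1 : α < 1) (hv : v ≤ n) (hq0 : 0 ≤ q)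
    (hq : ∀ w < v, (w + 1 : ℝ) ≤ q * (n - w)) :
    (1 - q ^ 2 * ((1 - α) / α)) * ∑ w ∈ Finset.range (v + 1), binProb α n w * ballSize n w ≤
      binProb α n v * ballSize n v := by
  have hα : α ∈ Set.Icc (0 : ℝ) 1 := ⟨hα0.le, hα1.le⟩
  have hα' : 0 ≤ (1 - α) / α := div_nonneg (by linarith) hα0.le
  have hball : ∀ w, 0 ≤ ballSize n w := fun w => Finset.sum_nonneg fun j _ => Nat.cast_nonneg _
  refine geom_sum_le (a := fun w => binProb α n w * ballSize n w) (by positivity)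
    (mul_nonneg (binProb_nonneg hα _ _) (hball _)) (fun w hw => ?_) le_rfl
  have h1 : binProb α n w ≤ q * ((1 - α) / α) * binProb α n (w + 1) := by
    rw [binProb, binProb, wordProb_succ hα0 (show w < n by omega)]
    have := mul_le_mul_of_nonneg_right (choose_le_of_odds hv hq hw)
      (mul_nonneg hα' (wordProb_nonneg hα n (w + 1)))
    linarith
  calc binProb α n w * ballSize n w
      ≤ (q * ((1 - α) / α) * binProb α n (w + 1)) * (q * ballSize n (w + 1)) :=
        mul_le_mul h1 (ballSize_le_of_odds hv hq0 hq hw) (hball _)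
          (mul_nonneg (by positivity) (binProb_nonneg hα _ _))
    _ = _ := by ring

end Growth

/-- The Neyman–Pearson bound: a test that accepts the noise more often than a Hamming ball is
larger than the ball. -/
lemma ballSize_le_sum_of_isTest {α ε : ℝ} (hα0 : 0 < α) (hα2 : α < 1 / 2) {n u : ℕ} (hu : u ≤ n)
    (hcdf : binCdf α n u < 1 - ε) {Λ : (Fin n → Fin 2) → ℝ} (hΛ : IsTest α ε Λ) :
    ballSize n u ≤ ∑ e, Λ e := by
  have hα : α ∈ Set.Icc (0 : ℝ) 1 := ⟨hα0.le, by linarith⟩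
  have hpos : 0 < wordProb α n u := mul_pos (pow_pos hα0 _) (pow_pos (by linarith) _)
  have h1 : ∑ e : Fin n → Fin 2, (if hammingNorm e ≤ u then wordProb α n (hammingNorm e) else 0)
      = binCdf α n u := sum_hammingNorm_ite hu _
  have h2 : ∑ e : Fin n → Fin 2, (if hammingNorm e ≤ u then (1 : ℝ) else 0) = ballSize n u := by
    simpa [ballSize] using sum_hammingNorm_ite hu fun _ => 1
  have h3 := hΛ.2
  simp only [iidPow_bern] at h3
  -- The Neyman–Pearson argument: word probabilities decrease with weight, so the two factors never
  -- have opposite signs.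
  have h4 : 0 ≤ ∑ e : Fin n → Fin 2, (Λ e - if hammingNorm e ≤ u then 1 else 0) *
      (wordProb α n u - wordProb α n (hammingNorm e)) := by
    refine Finset.sum_nonneg fun e _ => ?_
    split_ifs with he
    · exact mul_nonneg_of_nonpos_of_nonpos (by linarith [(hΛ.1 e).2])
        (by linarith [wordProb_antitone hα0 hα2 he hu])
    · exact mul_nonneg (by linarith [(hΛ.1 e).1])
        (by linarith [wordProb_antitone hα0 hα2 (not_le.mp he).le (hammingNorm_le e)])
  have h5 : ∑ e : Fin n → Fin 2, (Λ e - if hammingNorm e ≤ u then 1 else 0) *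
      (wordProb α n u - wordProb α n (hammingNorm e)) =
      wordProb α n u * (∑ e, Λ e - ballSize n u) -
        (∑ e, Λ e * wordProb α n (hammingNorm e) - binCdf α n u) := by
    rw [← h1, ← h2, ← Finset.sum_sub_distrib, ← Finset.sum_sub_distrib, Finset.mul_sum,
      ← Finset.sum_sub_distrib]
    refine Finset.sum_congr rfl fun e _ => ?_
    split_ifs <;> ring
  have h6 : 0 ≤ wordProb α n u * (∑ e, Λ e - ballSize n u) := by linarith
  have := nonneg_of_mul_nonneg_right h6 hpos
  linarith

/-! ### Codes that match the converse up to a constant -/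

/-- The code sizes of coset codes with error at most `ε` match the converse bound for tests up to
the factor `K`. -/
def MatchesConverse (α ε K : ℝ) (n : ℕ) : Prop :=
  ∃ (C : AddSubgroup (Fin n → Fin 2)) (T : Finset (Fin n → Fin 2)), IsTransversal C T ∧
    1 - ε ≤ ∑ t ∈ T, iidPow n (bern α) t ∧
    ∀ Λ : (Fin n → Fin 2) → ℝ, IsTest α ε Λ → 2 ^ n ≤ K * Nat.card C * ∑ e, Λ e

lemma IsTest.sum_nonneg {α ε : ℝ} {n : ℕ} {Λ : (Fin n → Fin 2) → ℝ} (h : IsTest α ε Λ) :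
    0 ≤ ∑ e, Λ e := Finset.sum_nonneg fun e _ => (h.1 e).1

lemma MatchesConverse.mono {α ε K K' : ℝ} {n : ℕ} (h : MatchesConverse α ε K n) (hK : K ≤ K') :
    MatchesConverse α ε K' n := by
  obtain ⟨C, T, hT, hP, hΛ⟩ := h
  refine ⟨C, T, hT, hP, fun Λ hΛ' => (hΛ Λ hΛ').trans ?_⟩
  have := hΛ'.sum_nonneg
  gcongr

lemma IsTest.le_sum {α ε : ℝ} (hα : α ∈ Set.Icc (0 : ℝ) 1) {n : ℕ} {Λ : (Fin n → Fin 2) → ℝ}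
    (h : IsTest α ε Λ) : 1 - ε ≤ ∑ e, Λ e := by
  refine h.2.trans (Finset.sum_le_sum fun e _ => mul_le_of_le_one_right (h.1 e).1 ?_)
  rw [← sum_iidPow_bern α n]
  exact Finset.single_le_sum (fun s _ => iidPow_nonneg (bern_nonneg hα) s) (Finset.mem_univ e)

/-- The one-element code, with all strings as transversal, makes no error. It suffices when the
converse only allows bounded sizes. -/
lemma matchesConverse_of_trivial {α ε K : ℝ} {n : ℕ} (hε : 0 ≤ ε)
    (h : ∀ Λ : (Fin n → Fin 2) → ℝ, IsTest α ε Λ → 2 ^ n ≤ K * ∑ e, Λ e) :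
    MatchesConverse α ε K n := by
  refine ⟨⊥, Finset.univ, fun g => ⟨g, by simp, fun t ht => ?_⟩, ?_, fun Λ hΛ => ?_⟩
  · have := ht.2
    rw [AddSubgroup.mem_bot, sub_eq_zero] at this
    exact this.symm
  · rw [sum_iidPow_bern]; linarith
  · simpa using h Λ hΛ

lemma matchesConverse_small {α ε : ℝ} (hα : α ∈ Set.Icc (0 : ℝ) 1) (hε : ε ∈ Set.Ico (0 : ℝ) 1)
    (n : ℕ) : MatchesConverse α ε (2 ^ n / (1 - ε)) n := by
  refine matchesConverse_of_trivial hε.1 fun Λ hΛ => ?_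
  have h1 : 0 < 1 - ε := by linarith [hε.2]
  rw [div_mul_eq_mul_div, le_div_iff₀ h1]
  exact mul_le_mul_of_nonneg_left (hΛ.le_sum hα) (by positivity)

lemma matchesConverse_noiseless {ε : ℝ} (hε : ε ∈ Set.Ico (0 : ℝ) 1) (n : ℕ) :
    MatchesConverse 0 ε (1 / (1 - ε)) n := by
  have h1 : 0 < 1 - ε := by linarith [hε.2]
  refine ⟨⊤, {0}, fun g => ⟨0, by simp, fun t ht => by simpa using ht.1⟩, ?_, fun Λ hΛ => ?_⟩
  · have : iidPow n (bern 0) 0 = 1 := by simp [iidPow, bern]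
    rw [Finset.sum_singleton, this]; linarith [hε.1]
  · have h2 := hΛ.le_sum (by simp)
    have h3 : (Nat.card (⊤ : AddSubgroup (Fin n → Fin 2)) : ℝ) = 2 ^ n := by
      simp [Nat.card_eq_fintype_card]
    rw [h3, one_div, inv_mul_eq_div, div_mul_eq_mul_div, le_div_iff₀ h1]
    exact mul_le_mul_of_nonneg_left h2 (by positivity)

/-- All patterns are equally likely, so every test already has total weight at least (1 - ε) 2^n. -/
lemma matchesConverse_half {ε : ℝ} (hε : ε ∈ Set.Ico (0 : ℝ) 1) (n : ℕ) :
    MatchesConverse (1 / 2) ε (1 / (1 - ε)) n := by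
  have h1 : 0 < 1 - ε := by linarith [hε.2]
  refine matchesConverse_of_trivial hε.1 fun Λ hΛ => ?_
  have h2 := hΛ.2
  simp only [iidPow_bern_half] at h2
  rw [← Finset.sum_mul, _root_.one_div_pow, mul_one_div, le_div_iff₀ (by positivity)] at h2
  rw [one_div, inv_mul_eq_div, le_div_iff₀ h1]
  linarith

/-- Every pattern has positive probability, so a test without error is identically 1. -/
lemma matchesConverse_zeroError {α : ℝ} (hα : α ∈ Set.Ioo (0 : ℝ) 1) (n : ℕ) :
    MatchesConverse α 0 1 n := by
  refine matchesConverse_of_trivial le_rfl fun Λ hΛ => ?_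
  have hpos : ∀ e : Fin n → Fin 2, 0 < iidPow n (bern α) e := fun e =>
    Finset.prod_pos fun t _ => by unfold bern; split_ifs <;> linarith [hα.1, hα.2]
  have h1 : ∑ e, (1 - Λ e) * iidPow n (bern α) e ≤ 0 := by
    have := hΛ.2
    simp only [sub_mul, one_mul, Finset.sum_sub_distrib, sum_iidPow_bern]
    linarith
  have h2 : ∀ e ∈ Finset.univ, 0 ≤ (1 - Λ e) * iidPow n (bern α) e := fun e _ =>
    mul_nonneg (by linarith [(hΛ.1 e).2]) (hpos e).le
  have h3 := (Finset.sum_eq_zero_iff_of_nonneg h2).mp (le_antisymm h1 (Finset.sum_nonneg h2))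
  have h4 : ∀ e, Λ e = 1 := fun e => by
    rcases mul_eq_zero.mp (h3 e (Finset.mem_univ e)) with h | h
    · linarith
    · exact absurd h (hpos e).ne'
  simp [h4]

/-- Flipping all bits exchanges the noise levels `α` and `1 - α`. -/
lemma MatchesConverse.flip {α ε K : ℝ} {n : ℕ} (h : MatchesConverse (1 - α) ε K n) :
    MatchesConverse α ε K n := by
  obtain ⟨C, T, hT, hP, hΛ⟩ := h
  have hflip : ∀ e : Fin n → Fin 2, iidPow n (bern α) (e + 1) = iidPow n (bern (1 - α)) e := by
    intro e
    refine Finset.prod_congr rfl fun t _ => ?_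
    have : ∀ s : Fin 2, bern α (s + 1) = bern (1 - α) s := by
      intro s; fin_cases s <;> simp [bern]
    exact this (e t)
  refine ⟨C, T.map (Equiv.addRight 1).toEmbedding, fun g => ?_, ?_, fun Λ hΛ' => ?_⟩
  · obtain ⟨t, ⟨h1, h2⟩, h3⟩ := hT (g - 1)
    refine ⟨t + 1, ⟨by simpa using h1, by rwa [add_comm, ← sub_sub]⟩, ?_⟩
    rintro t' ⟨h4, h5⟩
    obtain ⟨t'', h6, rfl⟩ := Finset.mem_map.mp h4
    have h7 : t'' = t := h3 t'' ⟨h6, by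
      have h8 : g - (t'' + 1) ∈ C := h5
      rwa [add_comm, ← sub_sub] at h8⟩
    rw [h7]
    rfl
  · rw [Finset.sum_map]
    simpa [hflip] using hP
  · have h1 := hΛ (fun e => Λ (e + 1)) ⟨fun e => hΛ'.1 _, by
      simp only [← hflip]
      exact hΛ'.2.trans_eq (Equiv.sum_comp (Equiv.addRight (1 : Fin n → Fin 2))
        fun e => Λ e * iidPow n (bern α) e).symm⟩
    exact h1.trans_eq (congrArg _ (Equiv.sum_comp (Equiv.addRight (1 : Fin n → Fin 2)) Λ))

/-- At x = α the expression equals α / (1 - α) < 1, and continuity leaves room to the right. The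
room is needed because w₀ is only known to lie near nα. -/
lemma exists_odds_parameter {α : ℝ} (hα0 : 0 < α) (hα2 : α < 1 / 2) :
    ∃ x, α < x ∧ x < 1 / 2 ∧ (x / (1 - x)) ^ 2 * ((1 - α) / α) < 1 := by
  have hcont : ContinuousAt (fun x : ℝ => (x / (1 - x)) ^ 2 * ((1 - α) / α)) α := by
    have : (1 : ℝ) - α ≠ 0 := by linarith
    fun_prop (disch := assumption)
  have h0 : (α / (1 - α)) ^ 2 * ((1 - α) / α) < 1 := by
    have h1 : 0 < 1 - α := by linarith
    have : (α / (1 - α)) ^ 2 * ((1 - α) / α) = α / (1 - α) := by field_simp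
    rw [this, div_lt_one h1]
    linarith
  have h1 := (hcont.eventually_lt_const h0).filter_mono
    (nhdsWithin_le_nhds (s := Set.Ioi α))
  have h2 : ∀ᶠ x in nhdsWithin α (Set.Ioi α), x ∈ Set.Ioo α (1 / 2) := Ioo_mem_nhdsGT hα2
  obtain ⟨x, h3, h4⟩ := (h1.and h2).exists
  exact ⟨x, h4.1, h4.2, h3⟩

/-- The coding step at fixed block length, for a radius `w₀` at which the error distribution
function crosses `1 - ε`. -/
lemma matchesConverse_of_radius {α ε : ℝ} (hα0 : 0 < α) (hα2 : α < 1 / 2) {n w₀ : ℕ}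
    (hw0 : 0 < w₀) (hwn : w₀ + 1 ≤ n) (hcdf : 1 - ε ≤ binCdf α n w₀)
    (hcdf' : binCdf α n (w₀ - 1) < 1 - ε) {q K₁ K₂ : ℝ} (hq0 : 0 ≤ q)
    (hq : ∀ w < w₀ + 1, (w + 1 : ℝ) ≤ q * (n - w)) (hr : q ^ 2 * ((1 - α) / α) < 1)
    (hK₁ : K₁ = 1 / (1 - q ^ 2 * ((1 - α) / α)))
    (hK₂ : ballSize n (w₀ + 1) ≤ K₂ * ballSize n (w₀ - 1)) (hε : 0 ≤ ε) :
    MatchesConverse α ε (2 * K₁ * K₂) n := by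
  have hα : α ∈ Set.Icc (0 : ℝ) 1 := ⟨hα0.le, by linarith⟩
  have hball : ∀ w, 1 ≤ ballSize n w := fun w => by
    rw [ballSize, Finset.sum_range_succ']
    have : 0 ≤ ∑ k ∈ Finset.range w, (n.choose (k + 1) : ℝ) :=
      Finset.sum_nonneg fun _ _ => Nat.cast_nonneg _
    simpa using this
  have hr' : 0 < 1 - q ^ 2 * ((1 - α) / α) := by linarith
  have hK1 : 1 ≤ K₁ := by
    rw [hK₁, le_div_iff₀ hr']
    have : 0 ≤ q ^ 2 * ((1 - α) / α) :=
      mul_nonneg (sq_nonneg q) (div_nonneg (by linarith) hα0.le)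
    linarith
  have hK2 : 0 < K₂ := by
    by_contra! hc
    nlinarith [hball (w₀ + 1), hball (w₀ - 1)]
  -- One more shell than is needed to reach probability 1 - ε: its probability is the budget for the
  -- coding error.
  set v := w₀ + 1 with hv
  have hlow : ∀ Λ : (Fin n → Fin 2) → ℝ, IsTest α ε Λ → ballSize n v ≤ K₂ * ∑ e, Λ e :=
    fun Λ hΛ => hK₂.trans (mul_le_mul_of_nonneg_left
      (ballSize_le_sum_of_isTest hα0 hα2 (by omega) hcdf' hΛ) hK2.le)
  set B := K₁ * ballSize n v with hB
  have hB1 : 1 ≤ B := by nlinarith [hball v]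
  have hBΛ : ∀ Λ : (Fin n → Fin 2) → ℝ, IsTest α ε Λ → B ≤ K₁ * K₂ * ∑ e, Λ e := fun Λ hΛ => by
    rw [hB, mul_assoc]
    exact mul_le_mul_of_nonneg_left (hlow Λ hΛ) (by linarith)
  -- If B exceeds 2^n, then so does a constant times ΣΛ for every test, and the trivial code is good
  -- enough.
  rcases lt_or_ge (2 ^ n) B with hlt | hge
  · refine matchesConverse_of_trivial hε fun Λ hΛ => ?_
    have h1 := hBΛ Λ hΛ
    nlinarith
  -- The dimension k is the largest with 2^k B ≤ 2^n. Rounding to a power of two causes the factor 2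
  -- in the constant.
  obtain ⟨k, hk1, hk2⟩ : ∃ k : ℕ, 2 ^ k * B ≤ 2 ^ n ∧ 2 ^ n < 2 ^ (k + 1) * B := by
    obtain ⟨k, hk1, hk2⟩ := exists_nat_pow_near (x := 2 ^ n / B) (y := (2 : ℝ))
      (by rw [le_div_iff₀ (by linarith)]; linarith) (by norm_num)
    exact ⟨k, by rwa [le_div_iff₀ (by linarith)] at hk1,
      by rwa [div_lt_iff₀ (by linarith)] at hk2⟩
  have hkn : k ≤ n := by
    have h1 : (2 : ℝ) ^ k ≤ 2 ^ n :=
      (le_mul_of_one_le_right (by positivity) hB1).trans hk1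
    exact (pow_le_pow_iff_right₀ (by norm_num)).mp h1
  obtain ⟨C, T, hC, hT, herr⟩ := exists_code_error_le (by omega) hkn
    (fun e => iidPow_nonneg (bern_nonneg hα) e : ∀ e : Fin n → Fin 2, 0 ≤ iidPow n (bern α) e)
    hammingNorm
  refine ⟨C, T, hT, ?_, fun Λ hΛ => ?_⟩
  · have h1 : ∑ e : Fin n → Fin 2, iidPow n (bern α) e * min (1 : ℝ) (2 ^ k / 2 ^ n *
        (Finset.univ.filter fun e' : Fin n → Fin 2 => hammingNorm e' ≤ hammingNorm e).card) ≤ ε := by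
      -- Inside the ball of radius v the union bound is used, outside it the bound 1.
      have h2 : ∀ e : Fin n → Fin 2, iidPow n (bern α) e * min (1 : ℝ) (2 ^ k / 2 ^ n *
          (Finset.univ.filter fun e' : Fin n → Fin 2 => hammingNorm e' ≤ hammingNorm e).card) ≤
          (if hammingNorm e ≤ v then wordProb α n (hammingNorm e) *
            (2 ^ k / 2 ^ n * ballSize n (hammingNorm e)) else 0) +
          (iidPow n (bern α) e - if hammingNorm e ≤ v then wordProb α n (hammingNorm e) else 0) := by
        intro e
        rw [card_hammingBall (hammingNorm_le e), iidPow_bern]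
        have h0 := wordProb_nonneg hα n (hammingNorm e)
        split_ifs
        · rw [sub_self, add_zero]
          exact mul_le_mul_of_nonneg_left (min_le_right _ _) h0
        · rw [sub_zero, zero_add]
          exact mul_le_of_le_one_right h0 (min_le_left _ _)
      refine (Finset.sum_le_sum fun e _ => h2 e).trans ?_
      rw [Finset.sum_add_distrib, Finset.sum_sub_distrib, sum_iidPow_bern,
        sum_hammingNorm_ite hwn fun w => wordProb α n w * (2 ^ k / 2 ^ n * ballSize n w),
        sum_hammingNorm_ite hwn fun w => wordProb α n w]
      have h3 : ∑ w ∈ Finset.range (v + 1), (n.choose w : ℝ) * wordProb α n w =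
          binCdf α n w₀ + binProb α n v := by
        rw [hv, Finset.sum_range_succ]; rfl
      have h4 : ∑ w ∈ Finset.range (v + 1), (n.choose w : ℝ) *
            (wordProb α n w * (2 ^ k / 2 ^ n * ballSize n w)) =
          2 ^ k / 2 ^ n * ∑ w ∈ Finset.range (v + 1), binProb α n w * ballSize n w := by
        rw [Finset.mul_sum]
        refine Finset.sum_congr rfl fun w _ => ?_
        rw [binProb]; ring
      have h5 : ∑ w ∈ Finset.range (v + 1), binProb α n w * ballSize n w ≤ binProb α n v * B := by
        have := sum_binProb_mul_ballSize_le hα0 (by linarith) hwn hq0 hq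
        rw [hB, hK₁, one_div, ← mul_assoc, mul_comm (binProb α n v), mul_assoc,
          inv_mul_eq_div, le_div_iff₀ hr']
        linarith
      -- The coding error inside the ball is at most the probability of the shell at v. It cancels
      -- the gain from enlarging the ball, leaving 1 - `binCdf α n w₀` ≤ ε.
      have h6 : (2 : ℝ) ^ k / 2 ^ n * (binProb α n v * B) ≤ binProb α n v := by
        rw [div_mul_eq_mul_div, div_le_iff₀ (by positivity)]
        have := mul_le_mul_of_nonneg_left hk1 (binProb_nonneg hα n v)
        linarith
      have h7 : (2 : ℝ) ^ k / 2 ^ n * ∑ w ∈ Finset.range (v + 1), binProb α n w * ballSize n w ≤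
          binProb α n v := (mul_le_mul_of_nonneg_left h5 (by positivity)).trans h6
      rw [h3, h4]
      linarith
    have h2 := Finset.sum_add_sum_compl T fun e => iidPow n (bern α) e
    rw [sum_iidPow_bern] at h2
    linarith
  · rw [hC]
    have h1 := mul_le_mul_of_nonneg_left (hBΛ Λ hΛ) (show (0 : ℝ) ≤ 2 ^ (k + 1) by positivity)
    push_cast
    rw [pow_succ] at hk2 h1
    linarith

lemma exists_matchesConverse_of_lt_half {α ε : ℝ} (hα0 : 0 < α) (hα2 : α < 1 / 2) (hε0 : 0 < ε)
    (hε1 : ε < 1) : ∃ (K : ℝ) (n₀ : ℕ), ∀ n, n₀ ≤ n → MatchesConverse α ε K n := by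
  have hα : α ∈ Set.Icc (0 : ℝ) 1 := ⟨hα0.le, by linarith⟩
  obtain ⟨x, hαx, hx2, hr⟩ := exists_odds_parameter hα0 hα2
  set q := x / (1 - x) with hq
  have hx1 : 0 < 1 - x := by linarith
  have hq0 : 0 ≤ q := div_nonneg (by linarith) hx1.le
  have hq1 : q < 1 := by rw [hq, div_lt_one hx1]; linarith
  -- The bound α / 2 will give w₀ ≥ nα / 2. The margin 2η, with nη ≥ 1, keeps w₀ + 1 below nx.
  obtain ⟨η, hη0, hη1, hη2⟩ : ∃ η : ℝ, 0 < η ∧ η ≤ α / 2 ∧ α + 2 * η ≤ x :=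
    ⟨min (α / 2) ((x - α) / 2), lt_min (by linarith) (by linarith), min_le_left _ _, by
      have := min_le_right (α / 2) ((x - α) / 2); linarith⟩
  -- A Chebyshev tail below δ is too small to reach 1 - ε from the left, and too small to remove
  -- more than ε from the right.
  obtain ⟨δ, hδ0, hδ1, hδ2⟩ : ∃ δ : ℝ, 0 < δ ∧ δ < ε ∧ δ < 1 - ε :=
    ⟨min ε (1 - ε) / 2, by have : 0 < min ε (1 - ε) := lt_min hε0 (by linarith)
                           linarith,
      by have := min_le_left ε (1 - ε); linarith, by have := min_le_right ε (1 - ε); linarith⟩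
  obtain ⟨n₁, hn₁⟩ := exists_nat_gt (1 / η)
  obtain ⟨n₂, hn₂⟩ := exists_nat_gt (1 / (δ * η ^ 2))
  -- The last factor compares the balls of radii w₀ + 1 and w₀ - 1: a ball is at most its outer
  -- shell divided by 1 - q, and each of the two steps between the shells costs at most 2 / α.
  refine ⟨2 * (1 / (1 - q ^ 2 * ((1 - α) / α))) * ((2 / α) ^ 2 / (1 - q)), max (max n₁ n₂) 1,
    fun n hn => ?_⟩
  have hn0 : 0 < n := lt_of_lt_of_le one_pos ((le_max_right _ _).trans hn)
  have hn' : (0 : ℝ) < n := by exact_mod_cast hn0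
  have hnη : 1 ≤ n * η := by
    have h1 : (n₁ : ℝ) ≤ n := by exact_mod_cast (le_max_left _ _).trans ((le_max_left _ _).trans hn)
    have := hn₁.trans_le h1
    rw [div_lt_iff₀ hη0] at this
    exact this.le
  have hdev : 1 / (n * η ^ 2) < δ := by
    have h1 : (n₂ : ℝ) ≤ n := by
      exact_mod_cast (le_max_right _ _).trans ((le_max_left _ _).trans hn)
    have := hn₂.trans_le h1
    rw [div_lt_iff₀ (by positivity)] at this ⊢
    linarith
  have hex : ∃ w, 1 - ε ≤ binCdf α n w := ⟨n, by rw [binCdf_self]; linarith⟩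
  classical
  -- Minimality of w₀ gives the strict inequality at w₀ - 1 that the Neyman–Pearson bound requires.
  set w₀ := Nat.find hex with hw₀
  have hw₀n : w₀ ≤ n := Nat.find_min' hex (by rw [binCdf_self]; linarith)
  have hcdf : 1 - ε ≤ binCdf α n w₀ := Nat.find_spec hex
  have hlow : n * (α - η) < w₀ := by
    by_contra! hc
    have h1 : binCdf α n w₀ ≤ 1 / (n * η ^ 2) := by
      refine sum_binProb_le_of_far hα hn0 hη0 (Finset.range_mono (by omega)) fun w hw => ?_
      have h2 : (w : ℝ) ≤ w₀ := by
        have := Finset.mem_range.mp hw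
        exact_mod_cast (by omega : w ≤ w₀)
      refine le_trans ?_ (le_abs_self _)
      linarith
    linarith
  have hupp : (w₀ : ℝ) ≤ n * (α + η) := by
    set u := ⌊n * (α + η)⌋₊ with hu
    have hu0 : (u : ℝ) ≤ n * (α + η) := Nat.floor_le (by positivity)
    have hun : u ≤ n := by
      have : (u : ℝ) ≤ n := hu0.trans (mul_le_of_le_one_right hn'.le (by linarith))
      exact_mod_cast this
    refine le_trans ?_ hu0
    have h1 : ∑ w ∈ Finset.range (n + 1) \ Finset.range (u + 1), binProb α n w ≤
        1 / (n * η ^ 2) := by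
      refine sum_binProb_le_of_far hα hn0 hη0 Finset.sdiff_subset fun w hw => ?_
      have h2 : u < w := by
        have := (Finset.mem_sdiff.mp hw).2
        rw [Finset.mem_range] at this
        omega
      have h3 := Nat.lt_of_floor_lt h2
      rw [abs_sub_comm]
      refine le_trans ?_ (le_abs_self _)
      linarith
    have h2 := Finset.sum_sdiff (f := binProb α n)
      (Finset.range_mono (show u + 1 ≤ n + 1 by omega))
    have h3 := binCdf_self α n
    have h4 : 1 - ε ≤ binCdf α n u := by
      rw [binCdf] at h3 ⊢
      linarith
    exact_mod_cast Nat.find_min' hex h4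
  have hw₀low : n * (α / 2) ≤ w₀ := by
    have : n * (α / 2) ≤ n * (α - η) := mul_le_mul_of_nonneg_left (by linarith) hn'.le
    linarith
  have hw₀pos : 0 < w₀ := by
    have : (0 : ℝ) < w₀ := lt_of_lt_of_le (by positivity) hw₀low
    exact_mod_cast this
  have hvx : (w₀ : ℝ) + 1 ≤ n * x := by
    have : n * (α + 2 * η) ≤ n * x := mul_le_mul_of_nonneg_left hη2 hn'.le
    linarith
  have hvn : w₀ + 1 ≤ n := by
    have : (w₀ : ℝ) + 1 ≤ n := hvx.trans (mul_le_of_le_one_right hn'.le (by linarith))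
    exact_mod_cast this
  have hodds : ∀ w < w₀ + 1, (w + 1 : ℝ) ≤ q * (n - w) := by
    intro w hw
    have h1 : (w : ℝ) ≤ w₀ := by exact_mod_cast (by omega : w ≤ w₀)
    have h2 : n * (1 - x) ≤ n - w := by linarith
    have h3 : q * (n * (1 - x)) = n * x := by rw [hq]; field_simp
    have := mul_le_mul_of_nonneg_left h2 hq0
    linarith
  have hstep : ∀ w, w₀ ≤ w + 1 → w ≤ n →
      (n.choose (w + 1) : ℝ) ≤ 2 / α * n.choose w := by
    intro w hw hwn
    have h1 : (n.choose (w + 1) : ℝ) * (w + 1) = n.choose w * (n - w) := by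
      have := Nat.choose_succ_right_eq n w
      rw [← Nat.cast_inj (R := ℝ)] at this
      push_cast [Nat.cast_sub hwn] at this
      exact this
    have h2 : (w₀ : ℝ) ≤ w + 1 := by exact_mod_cast hw
    have h3 : (n.choose (w + 1) : ℝ) * (n * (α / 2)) ≤ n.choose w * n := by
      calc _ ≤ (n.choose (w + 1) : ℝ) * (w + 1) :=
            mul_le_mul_of_nonneg_left (hw₀low.trans h2) (Nat.cast_nonneg _)
        _ = _ := h1
        _ ≤ _ := mul_le_mul_of_nonneg_left (by linarith [Nat.cast_nonneg (α := ℝ) w])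
            (Nat.cast_nonneg _)
    have h4 : ((n.choose (w + 1) : ℝ) * (α / 2)) * n ≤ n.choose w * n := by linarith
    have h5 := le_of_mul_le_mul_right h4 hn'
    rw [div_mul_eq_mul_div, le_div_iff₀ hα0]
    linarith
  refine matchesConverse_of_radius hα0 hα2 hw₀pos hvn hcdf
    (not_le.mp (Nat.find_min hex (by omega))) hq0 hodds hr rfl ?_ hε0.le
  have h1 := ballSize_le_choose hvn hq0 hodds
  have h2 := hstep w₀ (by omega) hw₀n
  have h3 := hstep (w₀ - 1) (by omega) (by omega)
  rw [Nat.sub_add_cancel hw₀pos] at h3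
  have h4 : (n.choose (w₀ - 1) : ℝ) ≤ ballSize n (w₀ - 1) :=
    Finset.single_le_sum (f := fun j => (n.choose j : ℝ)) (fun _ _ => Nat.cast_nonneg _)
      (Finset.mem_range.mpr (Nat.lt_succ_self _))
  rw [div_mul_eq_mul_div, le_div_iff₀ (by linarith)]
  have h5 : 0 < 2 / α := by positivity
  calc ballSize n (w₀ + 1) * (1 - q) ≤ n.choose (w₀ + 1) := by linarith
    _ ≤ 2 / α * (2 / α * n.choose (w₀ - 1)) := h2.trans (mul_le_mul_of_nonneg_left h3 h5.le)
    _ = (2 / α) ^ 2 * n.choose (w₀ - 1) := by ring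
    _ ≤ _ := mul_le_mul_of_nonneg_left h4 (by positivity)

lemma exists_matchesConverse_of_le_half {α ε : ℝ} (hα : α ∈ Set.Icc (0 : ℝ) (1 / 2))
    (hε : ε ∈ Set.Ico (0 : ℝ) 1) : ∃ K : ℝ, ∀ n, MatchesConverse α ε K n := by
  have hα' : α ∈ Set.Icc (0 : ℝ) 1 := ⟨hα.1, by linarith [hα.2]⟩
  rcases hα.1.eq_or_lt with rfl | hα0
  · exact ⟨_, matchesConverse_noiseless hε⟩
  rcases hα.2.eq_or_lt with rfl | hα2
  · exact ⟨_, matchesConverse_half hε⟩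
  rcases hε.1.eq_or_lt with rfl | hε0
  · exact ⟨_, matchesConverse_zeroError ⟨hα0, by linarith⟩⟩
  obtain ⟨K, n₀, h⟩ := exists_matchesConverse_of_lt_half hα0 hα2 hε0 hε.2
  have h1 : 0 < 1 - ε := by linarith [hε.2]
  refine ⟨max K (2 ^ n₀ / (1 - ε)), fun n => ?_⟩
  rcases le_or_gt n₀ n with hn | hn
  · exact (h n hn).mono (le_max_left _ _)
  · refine (matchesConverse_small hα' hε n).mono (le_trans ?_ (le_max_right _ _))
    gcongr
    norm_num

theorem exists_matchesConverse {α ε : ℝ} (hα : α ∈ Set.Icc (0 : ℝ) 1)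
    (hε : ε ∈ Set.Ico (0 : ℝ) 1) : ∃ K : ℝ, ∀ n, MatchesConverse α ε K n := by
  rcases le_total α (1 / 2) with h | h
  · exact exists_matchesConverse_of_le_half ⟨hα.1, h⟩ hε
  · obtain ⟨K, hK⟩ := exists_matchesConverse_of_le_half (α := 1 - α)
      ⟨by linarith [hα.2], by linarith⟩ hε
    exact ⟨K, fun n => (hK n).flip⟩

/-! ### The hypothesis testing divergence of the binary symmetric channel -/

/-- The noise of the binary symmetric channel as a function of input and output. -/
def noiseOf {n : ℕ} (z : Fin n → Bool × Bool) : Fin n → Fin 2 :=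
  fun t => if (z t).1 = (z t).2 then 0 else 1

/-- Pairs of bits are parametrized by the noise and the first bit. -/
def noiseEquiv : Bool × Bool ≃ Fin 2 × Bool where
  toFun z := (if z.1 = z.2 then 0 else 1, z.1)
  invFun w := (w.2, if w.1 = 0 then w.2 else !w.2)
  left_inv z := by rcases z with ⟨x, y⟩; cases x <;> cases y <;> simp
  right_inv w := by rcases w with ⟨s, x⟩; fin_cases s <;> cases x <;> simp

/-- Noise and first bit are independent and the bit is uniform, so a test of the noise alone has the
same mean before and after passing to pairs. -/
lemma sum_noiseOf {n : ℕ} (Λ : (Fin n → Fin 2) → ℝ) {P : Bool × Bool → ℝ} {p : Fin 2 → ℝ}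
    (h : ∀ z, P z = p (noiseEquiv z).1 / 2) :
    ∑ z, Λ (noiseOf z) * iidPow n P z = ∑ s, Λ s * iidPow n p s := by
  have h1 : ∑ z, Λ (noiseOf z) * iidPow n P z =
      ∑ w : (Fin n → Fin 2) × (Fin n → Bool), Λ w.1 * (iidPow n p w.1 * (1 / 2) ^ n) := by
    refine Fintype.sum_equiv ((Equiv.arrowCongr (Equiv.refl (Fin n)) noiseEquiv).trans
      (Equiv.arrowProdEquivProdArrow (Fin n) (fun _ => Fin 2) fun _ => Bool)) _ _ fun z => ?_
    congr 1
    have h2 : ∀ t, P (z t) = p (noiseEquiv (z t)).1 * (1 / 2) := fun t => by rw [h]; ring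
    simp only [iidPow, h2, Finset.prod_mul_distrib, Finset.prod_const, Finset.card_univ,
      Fintype.card_fin]
    rfl
  rw [h1, Fintype.sum_prod_type]
  refine Finset.sum_congr rfl fun s _ => ?_
  simp only [Finset.sum_const, Finset.card_univ, Fintype.card_fun, Fintype.card_bool,
    Fintype.card_fin, nsmul_eq_mul]
  push_cast
  have : (2 : ℝ) ^ n * (1 / 2) ^ n = 1 := by rw [← mul_pow]; norm_num
  linear_combination (Λ s * iidPow n p s) * this

/-- The joint distribution of a pair is at most twice the product distribution. The resulting
positive lower bound keeps `hypoBeta` away from 0, where the logarithm takes a default value. -/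
lemma le_sum_uniformPair {α ε : ℝ} (hα : α ∈ Set.Icc (0 : ℝ) 1) {n : ℕ}
    {Λ : (Fin n → Bool × Bool) → ℝ} (hΛ : ∀ z, 0 ≤ Λ z)
    (h : 1 - ε ≤ ∑ z, Λ z * iidPow n (bscJoint α) z) :
    (1 - ε) / 2 ^ n ≤ ∑ z, Λ z * iidPow n uniformPair z := by
  have h1 : ∀ z : Fin n → Bool × Bool, iidPow n (bscJoint α) z ≤ 2 ^ n * iidPow n uniformPair z := by
    intro z
    have h2 : (2 : ℝ) ^ n * iidPow n uniformPair z = ∏ t, 2 * uniformPair (z t) := by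
      rw [Finset.prod_mul_distrib, Finset.prod_const, Finset.card_univ, Fintype.card_fin]; rfl
    rw [h2]
    refine Finset.prod_le_prod (fun t _ => ?_) fun t _ => ?_
    · unfold bscJoint; split_ifs <;> linarith [hα.1, hα.2]
    · unfold bscJoint uniformPair; split_ifs <;> linarith [hα.1, hα.2]
  rw [div_le_iff₀ (by positivity), Finset.sum_mul]
  refine h.trans (Finset.sum_le_sum fun z _ => ?_)
  have := mul_le_mul_of_nonneg_left (h1 z) (hΛ z)
  linarith

/-- Applied to the noise between X and Y, the test competes in `hypoBeta`. Independent uniform bits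
have Bernoulli(1/2) noise, so its second weight is 2^(-n) ΣΛ ≤ 1/m. -/
lemma logb_le_hypoDiv {α ε : ℝ} (hα : α ∈ Set.Icc (0 : ℝ) 1) (hε : ε < 1) {n m : ℕ} (hm : 0 < m)
    {Λ : (Fin n → Fin 2) → ℝ} (hΛ : IsTest α ε Λ) (hmΛ : (m : ℝ) * ∑ s, Λ s ≤ 2 ^ n) :
    Real.logb 2 m ≤ hypoDiv ε (iidPow n (bscJoint α)) (iidPow n uniformPair) := by
  have hm' : (0 : ℝ) < m := by exact_mod_cast hm
  have hP : ∀ z, bscJoint α z = bern α (noiseEquiv z).1 / 2 := by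
    rintro ⟨x, y⟩; cases x <;> cases y <;> simp [bscJoint, bern, noiseEquiv]
  have hQ : ∀ z, uniformPair z = bern (1 / 2) (noiseEquiv z).1 / 2 := by
    rintro ⟨x, y⟩; cases x <;> cases y <;> simp [uniformPair, bern, noiseEquiv] <;> norm_num
  have hmem : ∑ z, Λ (noiseOf z) * iidPow n uniformPair z ∈
      {r | ∃ Λ : (Fin n → Bool × Bool) → ℝ, (∀ z, 0 ≤ Λ z ∧ Λ z ≤ 1) ∧
        1 - ε ≤ ∑ z, Λ z * iidPow n (bscJoint α) z ∧
        r = ∑ z, Λ z * iidPow n uniformPair z} :=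
    ⟨fun z => Λ (noiseOf z), fun z => hΛ.1 _, by rw [sum_noiseOf Λ hP]; exact hΛ.2, rfl⟩
  have hlow : ∀ r ∈ {r | ∃ Λ : (Fin n → Bool × Bool) → ℝ, (∀ z, 0 ≤ Λ z ∧ Λ z ≤ 1) ∧
        1 - ε ≤ ∑ z, Λ z * iidPow n (bscJoint α) z ∧
        r = ∑ z, Λ z * iidPow n uniformPair z}, (1 - ε) / 2 ^ n ≤ r := by
    rintro r ⟨Λ', h1, h2, rfl⟩
    exact le_sum_uniformPair hα (fun z => (h1 z).1) h2
  have hβ0 : 0 < hypoBeta ε (iidPow n (bscJoint α)) (iidPow n uniformPair) :=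
    lt_of_lt_of_le (div_pos (by linarith) (by positivity)) (le_csInf ⟨_, hmem⟩ hlow)
  have hβ : hypoBeta ε (iidPow n (bscJoint α)) (iidPow n uniformPair) ≤ (m : ℝ)⁻¹ := by
    refine (csInf_le ⟨_, hlow⟩ hmem).trans ?_
    rw [sum_noiseOf Λ hQ]
    simp only [iidPow_bern_half]
    rw [← Finset.sum_mul, _root_.one_div_pow, mul_one_div, div_le_iff₀ (by positivity),
      inv_mul_eq_div, le_div_iff₀ hm']
    linarith
  rw [hypoDiv, le_neg, ← Real.logb_inv]
  exact Real.logb_le_logb_of_le (by norm_num) hβ0 hβ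

/-! ### Trivial codes -/

lemma entFid_eq_one {Φ : Matrix (Fin 1) (Fin 1) ℂ →ₗ[ℂ] Matrix (Fin 1) (Fin 1) ℂ}
    (h : ∀ X, (Φ X).trace = X.trace) : entFid Φ = 1 := by
  have := h (Matrix.single 0 0 1)
  simp only [Matrix.trace, Finset.univ_unique, Finset.sum_singleton, Matrix.diag_apply] at this
  simp only [entFid, Finset.univ_unique, Finset.sum_singleton]
  rw [show (default : Fin 1) = 0 from rfl] at this ⊢
  rw [this]
  simp

lemma trace_ampliate {a b r : Type} [Fintype a] [Fintype b] [Fintype r]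
    {Φ : Matrix a a ℂ →ₗ[ℂ] Matrix b b ℂ} (h : ∀ X, (Φ X).trace = X.trace)
    (X : Matrix (r × a) (r × a) ℂ) : (ampliate r Φ X).trace = X.trace := by
  simp only [Matrix.trace, Fintype.sum_prod_type, Matrix.diag_apply, ampliate_apply]
  refine Finset.sum_congr rfl fun s _ => ?_
  exact h (Matrix.of fun i j => X (s, i) (s, j))

lemma trace_tensorPow {a b S : Type} [Fintype S] [Fintype a] [DecidableEq a] [Fintype b]
    {p : S → ℝ} {K : S → Matrix b a ℂ} (hp : ∑ s, p s = 1) (hK : ∀ s, (K s)ᴴ * K s = 1) {n : ℕ}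
    (X : Matrix (Fin n → a) (Fin n → a) ℂ) :
    (tensorPow (∑ s, (p s : ℂ) • conjBy (K s)) n X).trace = X.trace := by
  rw [tensorPow_sum_conjBy]
  simp only [LinearMap.sum_apply, LinearMap.smul_apply, Matrix.trace_sum, Matrix.trace_smul,
    trace_conjBy, conjTranspose_tens, tens_mul, hK, tens_one, Matrix.one_mul]
  rw [← Finset.sum_smul, ← Complex.ofReal_sum, sum_iidPow, hp]
  simp

lemma trace_tensorPow_dephasing (γ : ℝ) {n : ℕ} (X : Matrix (Fin n → Fin 2) (Fin n → Fin 2) ℂ) :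
    (tensorPow (dephasing γ) n X).trace = X.trace := by
  rw [dephasing_eq]
  exact trace_tensorPow (sum_bern γ)
    (fun s => by rw [conjTranspose_phaseOp, phaseOp_mul_self]) X

lemma trace_tensorPow_depolarizing (α : ℝ) {n : ℕ}
    (X : Matrix (Fin n → Fin 2) (Fin n → Fin 2) ℂ) :
    (tensorPow (depolarizing α) n X).trace = X.trace := by
  rw [tensorPow_depolarizing]
  have h : ∀ i : Fin n → Fin 3, ∀ Y, (conjBy (wordRot i) Y).trace = Y.trace := fun i =>
    (isChannel_conjBy (by rw [conjTranspose_wordRot, wordRot_mul_self])).2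
  simp only [LinearMap.sum_apply, LinearMap.smul_apply, Matrix.trace_sum, Matrix.trace_smul,
    LinearMap.comp_apply, h, trace_tensorPow_dephasing]
  rw [Finset.sum_const, Finset.card_univ, Fintype.card_fun]
  simp

lemma isChannel_prepare {b : Type} [Fintype b] [DecidableEq b] (g : b) :
    IsChannel (conjBy (Matrix.of fun k (_ : Fin 1) => if k = g then (1 : ℂ) else 0)) :=
  isChannel_conjBy (by
    ext i j
    simp [Matrix.mul_apply, Matrix.one_apply, Subsingleton.elim i j])

/-- The Kraus operators of the trace. -/
def traceKraus {b : Type} [DecidableEq b] (g : b) : Matrix (Fin 1) b ℂ :=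
  Matrix.of fun _ k => if k = g then 1 else 0

lemma sum_traceKraus {b : Type} [Fintype b] [DecidableEq b] :
    ∑ g : b, (traceKraus g)ᴴ * traceKraus g = 1 := by
  ext i j
  rw [Matrix.sum_apply]
  simp [traceKraus, Matrix.mul_apply, Matrix.one_apply, eq_comm]

lemma isCode_one {N : Matrix (Fin 2) (Fin 2) ℂ →ₗ[ℂ] Matrix (Fin 2) (Fin 2) ℂ} {n : ℕ} {ε : ℝ}
    (hN : ∀ X, (tensorPow N n X).trace = X.trace) (hε : 0 ≤ ε) : IsCode N n ε 1 := by
  refine ⟨_, _, isChannel_prepare 0, isChannel_sum_conjBy Finset.univ traceKraus sum_traceKraus, ?_⟩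
  rw [entFid_eq_one]
  · linarith
  · intro X
    rw [LinearMap.comp_apply, LinearMap.comp_apply,
      (isChannel_sum_conjBy Finset.univ traceKraus sum_traceKraus).2, hN, (isChannel_prepare 0).2]

lemma isLOCCToBob_trace {b : Type} [Fintype b] [DecidableEq b] :
    ∃ D : Matrix (Fin 1 × b) (Fin 1 × b) ℂ →ₗ[ℂ] Matrix (Fin 1) (Fin 1) ℂ, IsLOCCToBob D :=
  ⟨_, _, IsLOCC.alice (a' := Unit) (ι := Unit) (fun _ => Matrix.of fun _ _ => 1)
    (by ext i j; simp [Matrix.mul_apply, Matrix.one_apply, Subsingleton.elim i j]) _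
    (fun _ => IsLOCC.bob traceKraus sum_traceKraus _ fun _ => IsLOCC.done), rfl⟩

lemma isCppCode_one {N : Matrix (Fin 2) (Fin 2) ℂ →ₗ[ℂ] Matrix (Fin 2) (Fin 2) ℂ} {n : ℕ} {ε : ℝ}
    (hN : ∀ X, (tensorPow N n X).trace = X.trace) (hε : 0 ≤ ε) : IsCppCode N n ε 1 := by
  obtain ⟨D, hD⟩ := isLOCCToBob_trace (b := Fin n → Fin 2)
  refine ⟨1, _, D, isChannel_prepare (0, 0), hD, ?_⟩
  rw [entFid_eq_one]
  · linarith
  · intro X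
    rw [LinearMap.comp_apply, LinearMap.comp_apply, hD.isChannel.2, trace_ampliate hN,
      (isChannel_prepare _).2]

/-! ### Optimal rates -/

/-- Only finitely many code sizes are possible, so the largest one attains the supremum. The code of
size 1 ensures that there is one. -/
lemma exists_isGreatest_rate {S : ℕ → Prop} (h1 : S 1) (hpos : ∀ m, S m → 0 < m) {B : ℝ}
    (hB : ∀ m, S m → (m : ℝ) ≤ B) (n : ℕ) :
    ∃ m, S m ∧ IsGreatest {R : ℝ | ∃ m : ℕ, S m ∧ R ≤ 1 / (n : ℝ) * Real.logb 2 m}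
      (1 / (n : ℝ) * Real.logb 2 m) := by
  have hfin : {m | S m}.Finite := (Set.finite_Iic ⌊B⌋₊).subset fun m hm => Nat.le_floor (hB m hm)
  obtain ⟨m, hm, hmax⟩ := Set.exists_max_image {m | S m} id hfin ⟨1, h1⟩
  refine ⟨m, hm, ⟨m, hm, le_rfl⟩, ?_⟩
  rintro R ⟨m', hm', hR⟩
  refine hR.trans (mul_le_mul_of_nonneg_left ?_ (by positivity))
  exact Real.logb_le_logb_of_le (by norm_num) (by exact_mod_cast hpos m' hm')
    (by exact_mod_cast hmax m' hm')

lemma natCast_le_of_exists_isTest {α ε : ℝ} (hα : α ∈ Set.Icc (0 : ℝ) 1) (hε : ε < 1) {n m : ℕ}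
    (h : ∃ Λ : (Fin n → Fin 2) → ℝ, IsTest α ε Λ ∧ (m : ℝ) * ∑ s, Λ s ≤ 2 ^ n) :
    (m : ℝ) ≤ 2 ^ n / (1 - ε) := by
  obtain ⟨Λ, hΛ, hm⟩ := h
  rw [le_div_iff₀ (by linarith)]
  exact (mul_le_mul_of_nonneg_left (hΛ.le_sum hα) (Nat.cast_nonneg m)).trans hm

section Rates

variable {S : Type} [Fintype S] {p : S → ℝ} {K : S → Matrix (Fin 2) (Fin 2) ℂ}
  {N : Matrix (Fin 2) (Fin 2) ℂ →ₗ[ℂ] Matrix (Fin 2) (Fin 2) ℂ} {n : ℕ} {ε B : ℝ}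

lemma exists_optRate_eq (hp : ∀ s, 0 ≤ p s) (hN : N = ∑ s, (p s : ℂ) • conjBy (K s))
    (htr : ∀ X, (tensorPow N n X).trace = X.trace) (hε : 0 ≤ ε)
    (hB : ∀ m : ℕ, 0 < m → IsCode N n ε m → (m : ℝ) ≤ B) :
    IsGreatest {R | Achievable N R n ε} (optRate N n ε) ∧
      ∃ m : ℕ, 0 < m ∧ IsCode N n ε m ∧ optRate N n ε = 1 / (n : ℝ) * Real.logb 2 m := by
  obtain ⟨m, hm, hgr⟩ := exists_isGreatest_rate (S := fun m => 0 < m ∧ IsCode N n ε m)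
    ⟨one_pos, isCode_one htr hε⟩ (fun _ h => h.1) (fun m h => hB m h.1 h.2) n
  simp only [← achievable_iff hp hN] at hgr
  have := hgr.csSup_eq
  rw [optRate, this]
  exact ⟨hgr, m, hm.1, hm.2, rfl⟩

lemma exists_optRateCpp_eq (hp : ∀ s, 0 ≤ p s) (hN : N = ∑ s, (p s : ℂ) • conjBy (K s))
    (htr : ∀ X, (tensorPow N n X).trace = X.trace) (hε : 0 ≤ ε)
    (hB : ∀ m : ℕ, 0 < m → IsCppCode N n ε m → (m : ℝ) ≤ B) :
    IsGreatest {R | AchievableCpp N R n ε} (optRateCpp N n ε) ∧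
      ∃ m : ℕ, 0 < m ∧ IsCppCode N n ε m ∧ optRateCpp N n ε = 1 / (n : ℝ) * Real.logb 2 m := by
  obtain ⟨m, hm, hgr⟩ := exists_isGreatest_rate (S := fun m => 0 < m ∧ IsCppCode N n ε m)
    ⟨one_pos, isCppCode_one htr hε⟩ (fun _ h => h.1) (fun m h => hB m h.1 h.2) n
  simp only [← achievableCpp_iff hp hN] at hgr
  have := hgr.csSup_eq
  rw [optRateCpp, this]
  exact ⟨hgr, m, hm.1, hm.2, rfl⟩

end Rates

end QuantumCoding

end

theorem mainTheorem5 (α : ℝ) (hα : α ∈ Set.Icc (0 : ℝ) 1) (ε : ℝ) (hε : ε ∈ Set.Ico (0 : ℝ) 1) :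
    (∀ n : ℕ, 0 < n →
      (IsGreatest {R | QuantumCoding.Achievable (QuantumCoding.depolarizing α) R n ε}
          (QuantumCoding.optRate (QuantumCoding.depolarizing α) n ε) ∧
        IsGreatest {R | QuantumCoding.Achievable (QuantumCoding.dephasing α) R n ε}
          (QuantumCoding.optRate (QuantumCoding.dephasing α) n ε) ∧
        IsGreatest {R | QuantumCoding.AchievableCpp (QuantumCoding.depolarizing α) R n ε}
          (QuantumCoding.optRateCpp (QuantumCoding.depolarizing α) n ε) ∧
        IsGreatest {R | QuantumCoding.AchievableCpp (QuantumCoding.dephasing α) R n ε}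
          (QuantumCoding.optRateCpp (QuantumCoding.dephasing α) n ε)) ∧
      QuantumCoding.optRate (QuantumCoding.depolarizing α) n ε ≤
        QuantumCoding.optRate (QuantumCoding.dephasing α) n ε ∧
      QuantumCoding.optRateCpp (QuantumCoding.depolarizing α) n ε ≤
        QuantumCoding.optRateCpp (QuantumCoding.dephasing α) n ε ∧
      QuantumCoding.optRateCpp (QuantumCoding.dephasing α) n ε ≤
        1 / (n : ℝ) * QuantumCoding.hypoDiv ε
          (QuantumCoding.iidPow n (QuantumCoding.bscJoint α))
          (QuantumCoding.iidPow n QuantumCoding.uniformPair)) ∧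
    ∃ C : ℝ, ∀ n : ℕ, 0 < n →
      QuantumCoding.optRateCpp (QuantumCoding.depolarizing α) n ε ≤
        QuantumCoding.optRate (QuantumCoding.dephasing α) n ε + C / n := by
  open QuantumCoding in
  have hpZ := bern_nonneg hα
  have hpD : ∀ s : Fin 3 × Fin 2, 0 ≤ 1 / 3 * bern α s.2 := fun s => by
    have := hpZ s.2
    positivity
  have hD := fun n => exists_optRate_eq (n := n) hpD (depolarizing_eq α)
    (trace_tensorPow_depolarizing α) hε.1 fun m hm h =>
      natCast_le_of_exists_isTest hα hε.2 (h.dephasing_of_depolarizing.exists_isTest hm)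
  have hZ := fun n => exists_optRate_eq (n := n) hpZ (dephasing_eq α)
    (trace_tensorPow_dephasing α) hε.1 fun m hm h =>
      natCast_le_of_exists_isTest hα hε.2 (h.exists_isTest hm)
  have hDc := fun n => exists_optRateCpp_eq (n := n) hpD (depolarizing_eq α)
    (trace_tensorPow_depolarizing α) hε.1 fun m hm h =>
      natCast_le_of_exists_isTest hα hε.2 (h.dephasing_of_depolarizing.exists_isTest hm)
  have hZc := fun n => exists_optRateCpp_eq (n := n) hpZ (dephasing_eq α)
    (trace_tensorPow_dephasing α) hε.1 fun m hm h =>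
      natCast_le_of_exists_isTest hα hε.2 (h.exists_isTest hm)
  refine ⟨fun n hn => ⟨⟨(hD n).1, (hZ n).1, (hDc n).1, (hZc n).1⟩, ?_, ?_, ?_⟩, ?_⟩
  · obtain ⟨m, hm, hc, hR⟩ := (hD n).2
    exact (hZ n).1.2 ((achievable_iff hpZ (dephasing_eq α)).mpr
      ⟨m, ⟨hm, hc.dephasing_of_depolarizing⟩, hR.le⟩)
  · obtain ⟨m, hm, hc, hR⟩ := (hDc n).2
    exact (hZc n).1.2 ((achievableCpp_iff hpZ (dephasing_eq α)).mpr
      ⟨m, ⟨hm, hc.dephasing_of_depolarizing⟩, hR.le⟩)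
  · obtain ⟨m, hm, hc, hR⟩ := (hZc n).2
    obtain ⟨Λ, hΛ, hmΛ⟩ := hc.exists_isTest hm
    rw [hR]
    exact mul_le_mul_of_nonneg_left (logb_le_hypoDiv hα hε.2 hm hΛ hmΛ) (by positivity)
  · obtain ⟨K, hK⟩ := exists_matchesConverse hα hε
    -- The constant is the logarithm of the factor K between converse and coset codes, which does
    -- not depend on n.
    refine ⟨Real.logb 2 K, fun n hn => ?_⟩
    obtain ⟨m, hm, hc, hR⟩ := (hDc n).2
    obtain ⟨Λ, hΛ, hmΛ⟩ := hc.dephasing_of_depolarizing.exists_isTest hm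
    obtain ⟨C, T, hT, hP, hmatch⟩ := hK n
    have hcard : 0 < Nat.card C := Nat.card_pos
    have hm' : (0 : ℝ) < m := by exact_mod_cast hm
    have hcard' : (0 : ℝ) < Nat.card C := by exact_mod_cast hcard
    have hΛ0 : 0 < ∑ s, Λ s := by linarith [hΛ.le_sum hα, hε.2]
    -- The test obtained from the assisted code is the one inserted in the matching bound, and its
    -- total weight cancels.
    have hmK : (m : ℝ) ≤ K * Nat.card C :=
      le_of_mul_le_mul_right (hmΛ.trans (hmatch Λ hΛ)) hΛ0
    have hK0 : 0 < K := pos_of_mul_pos_left (hm'.trans_le hmK) hcard'.le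
    have h1 : Real.logb 2 m ≤ Real.logb 2 K + Real.logb 2 (Nat.card C) := by
      rw [← Real.logb_mul hK0.ne' hcard'.ne']
      exact Real.logb_le_logb_of_le (by norm_num) hm' hmK
    have h2 : 1 / (n : ℝ) * Real.logb 2 (Nat.card C) ≤ optRate (dephasing α) n ε :=
      (hZ n).1.2 ((achievable_iff hpZ (dephasing_eq α)).mpr
        ⟨_, ⟨hcard, isCode_of_isTransversal hT hα hP⟩, le_rfl⟩)
    have h3 : 1 / (n : ℝ) * Real.logb 2 m ≤
        1 / (n : ℝ) * (Real.logb 2 K + Real.logb 2 (Nat.card C)) :=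
      mul_le_mul_of_nonneg_left h1 (by positivity)
    rw [hR]
    have h4 : Real.logb 2 K / n = 1 / (n : ℝ) * Real.logb 2 K := by ring
    rw [h4]
    linarith
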